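/- For $n\ge 0$ let $\mathfrak S_n$ be the set of permutations $\pi=\pi_1\pi_2\cdots\pi_n$ of $\{1,\dots,n\}$, and put $$\mathrm{des}(\pi)=\#\{i\in\{1,\dots,n-1\}:\pi_i>\pi_{i+1}\},\qquad \mathrm{exc}(\pi)=\#\{i\in\{1,\dots,n-1\}:\pi_i>i\},\qquad \mathrm{maj}(\pi)=\sum_{i\,:\,\pi_i>\pi_{i+1}} i .$$ An admissible inversion of $\pi$ is a pair $(\pi_i,\pi_j)$ with $i<j$ and $\pi_i>\pi_j$ such that either $1<i$ and $\pi_{i-1}<\pi_i$, or there is some $k$ with $i<k<j$ and $\pi_i<\pi_k$; let $\mathrm{ai}(\pi)$ be the number of admissible inversions of $\pi$. Let $\mathrm{PRW}_n$ be the set of all $\pi\in\mathfrak S_n$ that either have no ascent (an index $i$ with $1\le i\le n-1$ and $\pi_i<\pi_{i+1}$), or for which the smallest such index $i$ satisfies $\pi_i=1$. The $q$-Eulerian polynomials, the $q$-binomial coefficients and the $q$-binomial-Eulerian polynomials are $$A_n(t,q)=\sum_{\pi\in\mathfrak S_n}t^{\mathrm{exc}(\pi)}q^{\mathrm{maj}(\pi)-\mathrm{exc}(\pi)},\qquad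 {n\brack m}_q=\frac{(q;q)_n}{(q;q)_m(q;q)_{n-m}},\qquad \tilde A_n(t,q)=1+t\sum_{m=1}^n{n\brack m}_qA_m(t,q),$$ where $(q;q)_n=\prod_{i=1}^n(1-q^i)$. **Theorem.** For every $n\ge1$, $$\tilde A_n(t,q)=\sum_{\pi\in\mathrm{PRW}_{n+1}}t^{\mathrm{des}(\pi)}q^{\mathrm{ai}(\pi)}$$ as polynomials in $t$ and $q$. -/

import Mathlib

open Polynomial

namespace QBinEul

/-! A permutation `w : Equiv.Perm (Fin n)` is read as the word `w 0, w 1, …, w (n - 1)`.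
Positions and letters are numbered from `0`, so the position `i : Fin n` stands for the
position `i + 1` of the usual numbering and the letter `a : Fin n` for the letter `a + 1`. -/

/-- `w` has a descent at the position `i`: the next letter exists and is smaller. -/
def IsDescent {n : ℕ} (w : Equiv.Perm (Fin n)) (i : Fin n) : Prop :=
  ∃ h : (i : ℕ) + 1 < n, w ⟨(i : ℕ) + 1, h⟩ < w i

instance {n : ℕ} (w : Equiv.Perm (Fin n)) (i : Fin n) : Decidable (IsDescent w i) := by
  unfold IsDescent; infer_instance

/-- `w` has an ascent at the position `i`: the next letter exists and is larger. -/
def IsAscent {n : ℕ} (w : Equiv.Perm (Fin n)) (i : Fin n) : Prop :=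
  ∃ h : (i : ℕ) + 1 < n, w i < w ⟨(i : ℕ) + 1, h⟩

instance {n : ℕ} (w : Equiv.Perm (Fin n)) (i : Fin n) : Decidable (IsAscent w i) := by
  unfold IsAscent; infer_instance

/-- The number of descents. -/
def des {n : ℕ} (w : Equiv.Perm (Fin n)) : ℕ :=
  (Finset.univ.filter fun i : Fin n => IsDescent w i).card

/-- The number of excedances. (The last position is never an excedance.) -/
def exc {n : ℕ} (w : Equiv.Perm (Fin n)) : ℕ :=
  (Finset.univ.filter fun i : Fin n => i < w i).card

/-- The major index: the sum of the descent positions, numbered from `1`. -/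
def maj {n : ℕ} (w : Equiv.Perm (Fin n)) : ℕ :=
  ∑ i ∈ Finset.univ.filter (fun i : Fin n => IsDescent w i), ((i : ℕ) + 1)

/-- The inversion at the positions `(i, j)` is admissible: it is an inversion, and either the
letter at `i` is preceded by a smaller letter, or a letter strictly between the two positions
is larger than the letter at `i`. -/
def IsAdmissibleInversion {n : ℕ} (w : Equiv.Perm (Fin n)) (i j : Fin n) : Prop :=
  (i < j ∧ w j < w i) ∧
    ((∃ k : Fin n, (k : ℕ) + 1 = (i : ℕ) ∧ w k < w i) ∨
      (∃ k : Fin n, i < k ∧ k < j ∧ w i < w k))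

instance {n : ℕ} (w : Equiv.Perm (Fin n)) (i j : Fin n) :
    Decidable (IsAdmissibleInversion w i j) := by
  unfold IsAdmissibleInversion; infer_instance

/-- The number of admissible inversions. -/
def ai {n : ℕ} (w : Equiv.Perm (Fin n)) : ℕ :=
  (Finset.univ.filter fun p : Fin n × Fin n => IsAdmissibleInversion w p.1 p.2).card

/-- The first ascent of `w`, if there is one, is at the smallest letter. -/
def IsPRW {n : ℕ} (w : Equiv.Perm (Fin n)) : Prop :=
  ∀ i : Fin n, IsAscent w i → (∀ j : Fin n, j < i → ¬ IsAscent w j) → (w i : ℕ) = 0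

instance {n : ℕ} (w : Equiv.Perm (Fin n)) : Decidable (IsPRW w) := by
  unfold IsPRW; infer_instance

/-- The set `PRW_n`. -/
def PRW (n : ℕ) : Finset (Equiv.Perm (Fin n)) :=
  Finset.univ.filter fun w => IsPRW w

/-- The number of excedances is at most the major index, so that the difference
`maj w - exc w` of natural numbers is the true difference. -/
theorem exc_le_maj {n : ℕ} (w : Equiv.Perm (Fin n)) : exc w ≤ maj w := by
  have key : ∀ i : Fin n, (∀ k, i ≤ k → ¬ IsDescent w k) → ¬ i < w i := by
    intro i hi hlt
    have step : ∀ m : ℕ, ∀ h : (i : ℕ) + m < n, (i : ℕ) + m < (w ⟨(i : ℕ) + m, h⟩ : ℕ) := by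
      intro m
      induction m with
      | zero => intro _; exact hlt
      | succ m ih =>
        intro h
        have h0 : (i : ℕ) + m < n := by omega
        have h1 := ih h0
        have h2 : ¬ w ⟨(i : ℕ) + m + 1, h⟩ < w ⟨(i : ℕ) + m, h0⟩ := fun hw =>
          hi ⟨(i : ℕ) + m, h0⟩ (Fin.le_def.2 (Nat.le_add_right _ _)) ⟨h, hw⟩
        have h3 : (w ⟨(i : ℕ) + m, h0⟩ : ℕ) ≤ (w ⟨(i : ℕ) + m + 1, h⟩ : ℕ) := not_lt.1 h2
        have h4 : w ⟨(i : ℕ) + m, h0⟩ ≠ w ⟨(i : ℕ) + m + 1, h⟩ := by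
          intro he
          have := congrArg Fin.val (w.injective he)
          simp at this
        have h5 : (w ⟨(i : ℕ) + m, h0⟩ : ℕ) ≠ (w ⟨(i : ℕ) + m + 1, h⟩ : ℕ) :=
          fun he => h4 (Fin.ext he)
        change (i : ℕ) + m + 1 < (w ⟨(i : ℕ) + m + 1, h⟩ : ℕ)
        omega
    have hn : (i : ℕ) < n := i.isLt
    have := step (n - 1 - i) (by omega)
    have h6 := (w ⟨(i : ℕ) + (n - 1 - i), by omega⟩).isLt
    omega
  by_cases hD : ∃ i, IsDescent w i
  · have hne : (Finset.univ.filter fun i : Fin n => IsDescent w i).Nonempty := by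
      obtain ⟨i, hi⟩ := hD
      exact ⟨i, by simpa using hi⟩
    obtain ⟨d, hd, hmax⟩ := Finset.exists_max_image _ (fun i : Fin n => (i : ℕ)) hne
    have hlt : ∀ i : Fin n, i < w i → i ≤ d := by
      intro i hi
      by_contra hcon
      refine key i (fun k hk hdk => ?_) hi
      have h1 : (k : ℕ) ≤ (d : ℕ) := hmax k (by simpa using hdk)
      have h2 : (d : ℕ) < (i : ℕ) := not_le.1 hcon
      have h3 : (i : ℕ) ≤ (k : ℕ) := hk
      omega
    calc exc w ≤ (Finset.Iic d).card := by
          refine Finset.card_le_card fun i hi => ?_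
          simp only [Finset.mem_filter, Finset.mem_univ, true_and] at hi
          exact Finset.mem_Iic.2 (hlt i hi)
      _ = (d : ℕ) + 1 := Fin.card_Iic d
      _ ≤ maj w := Finset.single_le_sum
          (f := fun i : Fin n => (i : ℕ) + 1) (fun _ _ => Nat.zero_le _) hd
  · have : exc w = 0 := by
      unfold exc
      rw [Finset.card_eq_zero, Finset.filter_eq_empty_iff]
      intro i _
      exact key i fun k _ hk => hD ⟨k, hk⟩
    omega

/-- The `q`-shifted factorial `(q;q)_n`, as a polynomial in `q = X`. -/
noncomputable def qPoch (n : ℕ) : ℚ[X] :=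
  ∏ i ∈ Finset.Icc 1 n, (1 - (X : ℚ[X]) ^ i)

/-- The `q`-binomial coefficient, as a polynomial in `q`; it is used for `m ≤ n` only, where
the division of polynomials is exact, see `qBinom_mul`. -/
noncomputable def qBinom (n m : ℕ) : ℚ[X] :=
  qPoch n / (qPoch m * qPoch (n - m))

theorem qPoch_succ (n : ℕ) : qPoch (n + 1) = qPoch n * (1 - (X : ℚ[X]) ^ (n + 1)) := by
  unfold qPoch
  rw [Finset.prod_Icc_succ_top (by omega)]

theorem qPoch_ne_zero (n : ℕ) : qPoch n ≠ 0 := by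
  unfold qPoch
  refine Finset.prod_ne_zero_iff.2 fun i hi h => ?_
  have h0 := congrArg (Polynomial.eval 0) h
  have hi' : i ≠ 0 := by have := (Finset.mem_Icc.1 hi).1; omega
  simp [hi'] at h0

theorem qPoch_mul_dvd (s : ℕ) : ∀ a b : ℕ, a + b = s → qPoch a * qPoch b ∣ qPoch s := by
  induction s with
  | zero =>
    intro a b h
    obtain ⟨rfl, rfl⟩ : a = 0 ∧ b = 0 := by omega
    simp [qPoch]
  | succ s ih =>
    intro a b h
    rcases a with _ | a
    · obtain rfl : b = s + 1 := by omega
      simp [qPoch]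
    rcases b with _ | b
    · obtain rfl : a = s := by omega
      simp [qPoch]
    have hs : s + 1 = (a + 1) + (b + 1) := by omega
    have h1 : (1 - (X : ℚ[X]) ^ (s + 1))
        = (1 - X ^ (a + 1)) + X ^ (a + 1) * (1 - X ^ (b + 1)) := by
      rw [hs]; ring
    rw [qPoch_succ s, h1, mul_add]
    refine dvd_add ?_ ?_
    · have := mul_dvd_mul (ih a (b + 1) (by omega)) (dvd_refl (1 - (X : ℚ[X]) ^ (a + 1)))
      rw [qPoch_succ a]
      convert this using 1
      ring
    · have := mul_dvd_mul (ih (a + 1) b (by omega)) (dvd_refl (1 - (X : ℚ[X]) ^ (b + 1)))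
      rw [qPoch_succ b, ← mul_assoc, mul_left_comm]
      exact Dvd.dvd.mul_left this _

/-- The division in the definition of the `q`-binomial coefficient is exact. -/
theorem qBinom_mul {n m : ℕ} (h : m ≤ n) :
    qBinom n m * (qPoch m * qPoch (n - m)) = qPoch n := by
  have hd := qPoch_mul_dvd n m (n - m) (by omega)
  unfold qBinom
  rw [mul_comm]
  exact EuclideanDomain.mul_div_cancel' (mul_ne_zero (qPoch_ne_zero _) (qPoch_ne_zero _)) hd

/-! Polynomials in `t` and `q` are elements of `ℚ[X][X]`: the outer variable is `t = X`, and
`q = C X` is the inner variable. -/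

/-- The `(maj, exc)`-`q`-Eulerian polynomial `A_n(t, q)`. -/
noncomputable def qEulerian (n : ℕ) : ℚ[X][X] :=
  ∑ w : Equiv.Perm (Fin n), X ^ exc w * C X ^ (maj w - exc w)

/-- The `q`-binomial-Eulerian polynomial. -/
noncomputable def qBinomialEulerian (n : ℕ) : ℚ[X][X] :=
  1 + X * ∑ m ∈ Finset.Icc 1 n, C (qBinom n m) * qEulerian m

end QBinEul

/-! Write `[n, k]` for the `q`-binomial coefficient, `A` for `qEulerian` and `B` for
`qBinomialEulerian`. The proof rests on two recurrences, with `k` running over `0, …, n`: `A (n+1) =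
A n + t ∑ [n, k] q^k A (n-k) A k - t q^n A n` (`qEulerian_succ`), `B (n+1) = B n + t ∑ [n, k] q^k B
(n-k) A k` (`qBinomialEulerian_succ`). Cutting a word at its largest letter, `L m R`, gives the same
recurrences for `t^des q^ai`. Every inversion from `L` to `R` is admissible because `m` stands
between, and the inversions starting at `m` are admissible exactly when `L` is nonempty. Hence
`t^des q^ai` sums to `A` over all words (`sum_listWeight`) and to `B` over the PRW words
(`sum_PRWFrom`).

The recurrence for `A` is the hard part, since its definition uses `maj` and `exc`. Each permutation
is paired with weakly decreasing sequences that drop strictly at prescribed places, as for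
P-partitions. Summing over these sequences produces `q^(maj - exc)` divided by `(q;q)_n`. Stable
sorting turns the pairs into barred words (`sum_isCompatible_eq_sum_isGood`), and the admissible
letters at a position depend only on the sorted word (`isGood_iff`). So the words of given content
are counted by a coefficient in a product of linear forms (`sum_isGood`), as in MacMahon's Master
Theorem.

The matrix of these forms is `α` times the all-ones matrix plus a triangular one. Eliminating a
variable preserves this shape and changes only `α`, which gives a closed form (`masterSum_mul_det`)
and a relation between the variables `x` and the same list without `x 0` (`masterSum_functional`).
For `x v = z q^v`, removing `x 0` amounts to `z ↦ q z`, and the coefficients of `z` yield the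
recurrence modulo every power of `q`.

The recurrence for `B` follows by a `q`-difference product rule, since the `q`-exponential
generating function of `B` is that of the constant `1` times `1 - t + t A(z)`. -/

namespace QBinEul

/-! ### A Master Theorem computed by eliminating one variable at a time. -/

section Master

/-- The product of `m` factors `ℓ`, with the first one replaced by `ℓ - e`. -/
def headPow {A : Type*} [CommRing A] (ℓ e : A) : ℕ → A
  | 0 => 1
  | m + 1 => (ℓ - e) * ℓ ^ m

theorem map_headPow {A B : Type*} [CommRing A] [CommRing B] (f : A →+* B) (ℓ e : A) (m : ℕ) :
    f (headPow ℓ e m) = headPow (f ℓ) (f e) m := by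
  cases m <;> simp [headPow]

/-- Splitting one factor `a + b X` off the power gives `(1 - b x) S_k = a x S_{k-1}` for the sums
`S_k` on the left. For `k = 0` the term with `a` vanishes by degree, so `(1 - b x) S_0 = 1`.
Nilpotence of `x` removes the boundary term of the index shift. -/
theorem sum_coeff_X_pow_mul_linear_pow {A : Type*} [CommRing A] {M : ℕ} {x a b u : A}
    (hx : x ^ (M + 1) = 0) (hu : u * (1 - b * x) = 1) (k : ℕ) :
    ∑ m ∈ Finset.range (M + 1), x ^ m * (X ^ k * (C a + C b * X) ^ m : A[X]).coeff m
      = u * (a * x * u) ^ k := by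
  have shift : ∀ f : ℕ → A, ∑ m ∈ Finset.range (M + 1), x ^ m * f m
      = f 0 + x * ∑ m ∈ Finset.range (M + 1), x ^ m * f (m + 1) := by
    intro f
    have h1 := Finset.sum_range_succ' (fun m => x ^ m * f m) (M + 1)
    rw [Finset.sum_range_succ, hx] at h1
    simp only [zero_mul, add_zero, pow_zero, one_mul] at h1
    rw [h1, Finset.mul_sum, add_comm]
    congr 1
    exact Finset.sum_congr rfl fun m _ => by ring
  induction k with
  | zero =>
    have hdeg : ∀ m : ℕ, ((C a + C b * X) ^ m : A[X]).coeff (m + 1) = 0 := by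
      intro m
      apply coeff_eq_zero_of_natDegree_lt
      have h1 : (C a + C b * X : A[X]).natDegree ≤ 1 := by
        rw [add_comm]; exact natDegree_linear_le
      have := natDegree_pow_le_of_le m h1
      omega
    have h := shift fun m => (X ^ 0 * (C a + C b * X) ^ m : A[X]).coeff m
    have h2 : ∀ m : ℕ, (X ^ 0 * (C a + C b * X) ^ (m + 1) : A[X]).coeff (m + 1)
        = b * (X ^ 0 * (C a + C b * X) ^ m : A[X]).coeff m := by
      intro m
      have : (X ^ 0 * (C a + C b * X) ^ (m + 1) : A[X])
          = C a * (C a + C b * X) ^ m + C b * ((C a + C b * X) ^ m * X) := by ring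
      rw [this, coeff_add, coeff_C_mul, coeff_C_mul, coeff_mul_X, hdeg]
      simp
    simp only [h2] at h
    have h0 : (X ^ 0 * (C a + C b * X) ^ 0 : A[X]).coeff 0 = 1 := by simp
    simp only [mul_left_comm _ b, ← Finset.mul_sum] at h
    rw [h0] at h
    linear_combination u * h - (∑ m ∈ Finset.range (M + 1),
      x ^ m * (X ^ 0 * (C a + C b * X) ^ m : A[X]).coeff m) * hu
  | succ k ih =>
    have h := shift fun m => (X ^ (k + 1) * (C a + C b * X) ^ m : A[X]).coeff m
    have h2 : ∀ m : ℕ, (X ^ (k + 1) * (C a + C b * X) ^ (m + 1) : A[X]).coeff (m + 1)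
        = a * (X ^ k * (C a + C b * X) ^ m : A[X]).coeff m
          + b * (X ^ (k + 1) * (C a + C b * X) ^ m : A[X]).coeff m := by
      intro m
      have : (X ^ (k + 1) * (C a + C b * X) ^ (m + 1) : A[X])
          = C a * (X ^ k * (C a + C b * X) ^ m * X)
            + C b * (X ^ (k + 1) * (C a + C b * X) ^ m * X) := by ring
      rw [this, coeff_add, coeff_C_mul, coeff_C_mul, coeff_mul_X, coeff_mul_X]
    simp only [h2] at h
    have h0 : (X ^ (k + 1) * (C a + C b * X) ^ 0 : A[X]).coeff 0 = 0 := by simp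
    simp only [mul_add, Finset.sum_add_distrib, mul_left_comm _ b, mul_left_comm _ a,
      ← Finset.mul_sum] at h
    rw [h0, ih] at h
    linear_combination u * h - (∑ m ∈ Finset.range (M + 1),
      x ^ m * (X ^ (k + 1) * (C a + C b * X) ^ m : A[X]).coeff m) * hu

/-- Lagrange inversion for a linear form: taking diagonal coefficients substitutes for `X` the
solution `a * x * u` of `y = x (a + b y)`. -/
theorem sum_coeff_mul_linear_pow {A : Type*} [CommRing A] {M : ℕ} {x a b u : A}
    (hx : x ^ (M + 1) = 0) (hu : u * (1 - b * x) = 1) (F : A[X]) :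
    ∑ m ∈ Finset.range (M + 1), x ^ m * (F * (C a + C b * X) ^ m).coeff m
      = u * F.eval (a * x * u) := by
  induction F using Polynomial.induction_on' with
  | add p q hp hq =>
    simp only [add_mul, coeff_add, mul_add, Finset.sum_add_distrib, hp, hq, eval_add]
  | monomial k f =>
    have h := sum_coeff_X_pow_mul_linear_pow hx hu k (a := a)
    rw [← C_mul_X_pow_eq_monomial]
    simp only [mul_assoc, coeff_C_mul, eval_mul, eval_C, eval_pow, eval_X] at h ⊢
    simp only [mul_left_comm _ f, ← Finset.mul_sum, h]

/-- Replacing one factor `ℓ` by `ℓ - t X` subtracts from each term `t x` times the preceding one,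
whence the factor `1 - t x`. -/
theorem sum_coeff_mul_headPow {A : Type*} [CommRing A] {M : ℕ} {x a b t u : A}
    (hx : x ^ (M + 1) = 0) (hu : u * (1 - b * x) = 1) (F : A[X]) :
    ∑ m ∈ Finset.range (M + 1), x ^ m * (F * headPow (C a + C b * X) (C t * X) m).coeff m
      = (1 - t * x) * u * F.eval (a * x * u) := by
  have h := sum_coeff_mul_linear_pow hx hu F (a := a)
  have h1 := Finset.sum_range_succ (fun m => x ^ m * (F * (C a + C b * X) ^ m).coeff m) M
  rw [h] at h1
  have h2 := Finset.sum_range_succ' (fun m => x ^ m * (F * (C a + C b * X) ^ m).coeff m) M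
  rw [h] at h2
  rw [Finset.sum_range_succ']
  have h3 : ∀ m : ℕ, x ^ (m + 1) * (F * headPow (C a + C b * X) (C t * X) (m + 1)).coeff (m + 1)
      = x ^ (m + 1) * (F * (C a + C b * X) ^ (m + 1)).coeff (m + 1)
        - t * x * (x ^ m * (F * (C a + C b * X) ^ m).coeff m) := by
    intro m
    have : F * headPow (C a + C b * X) (C t * X) (m + 1)
        = F * (C a + C b * X) ^ (m + 1) - C t * (F * (C a + C b * X) ^ m * X) := by
      rw [headPow]; ring
    rw [this, coeff_sub, coeff_C_mul, coeff_mul_X]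
    ring
  simp only [h3, Finset.sum_sub_distrib, ← Finset.mul_sum]
  simp only [headPow, pow_zero] at h2 ⊢
  have hx' : x * x ^ M = 0 := by rw [← hx]; ring
  linear_combination (-1 : A) * h2 + t * x * h1
    + t * (F * (C a + C b * X) ^ M).coeff M * hx'

open MvPolynomial in
/-- The linear form of the row `w` of the matrix with entries `α` below the diagonal, `α + t` on
the diagonal and `α + t - 1` above it. -/
noncomputable def rowForm {R : Type*} [CommRing R] (t α : R) {N : ℕ} (w : Fin N) :
    MvPolynomial (Fin N) R :=
  ∑ v, MvPolynomial.C (if v < w then α else if v = w then α + t else α + t - 1)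
    * MvPolynomial.X v

/-- The weighted sum of the diagonal coefficients of the products of the row forms. -/
noncomputable def masterSum {R : Type*} [CommRing R] (M : ℕ) (t α : R) {N : ℕ} (x : Fin N → R) :
    R :=
  ∑ c : Fin N → Fin (M + 1), (∏ v, x v ^ (c v : ℕ)) *
    MvPolynomial.coeff (Finsupp.equivFunOnFinite.symm fun v => (c v : ℕ))
      (∏ w, headPow (rowForm t α w) (MvPolynomial.C t * MvPolynomial.X w) (c w))

theorem finSuccEquiv_rowForm_zero {R : Type*} [CommRing R] (t α : R) (N : ℕ) :
    MvPolynomial.finSuccEquiv R N (rowForm t α 0)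
      = C (MvPolynomial.C (α + t - 1) * ∑ v, MvPolynomial.X v)
        + C (MvPolynomial.C (α + t)) * X := by
  simp only [rowForm, Fin.sum_univ_succ, map_add, map_mul, map_sum,
    MvPolynomial.finSuccEquiv_apply, MvPolynomial.eval₂Hom_C, Finset.mul_sum]
  simp [Fin.succ_ne_zero, add_comm]

theorem finSuccEquiv_rowForm_succ {R : Type*} [CommRing R] (t α : R) {N : ℕ} (w : Fin N) :
    MvPolynomial.finSuccEquiv R N (rowForm t α w.succ)
      = C (rowForm t α w) + C (MvPolynomial.C α) * X := by
  simp only [rowForm, Fin.sum_univ_succ, map_add, map_mul, map_sum,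
    MvPolynomial.finSuccEquiv_X_zero, MvPolynomial.finSuccEquiv_X_succ]
  simp [MvPolynomial.finSuccEquiv_apply, add_comm]

/-- The parameter `α` enters every row through the same form, the sum of all variables. This is why
elimination stays inside the family. -/
theorem rowForm_add {R : Type*} [CommRing R] (t α β : R) {N : ℕ} (w : Fin N) :
    rowForm t (α + β) w = rowForm t α w + MvPolynomial.C β * ∑ v, MvPolynomial.X v := by
  simp only [rowForm, Finset.mul_sum, ← Finset.sum_add_distrib, ← add_mul, ← map_add]
  refine Finset.sum_congr rfl fun v _ => ?_
  congr 2
  split_ifs <;> ring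

/-- Elimination of the variable of index `0`. By `sum_coeff_mul_headPow` it is replaced in the other
rows by `(α + t - 1) x₀ u` times the sum of the remaining variables. It has coefficient `α` there,
so by `rowForm_add` only `α` changes. -/
theorem masterSum_cons {R : Type*} [CommRing R] {M : ℕ} (t α : R) {N : ℕ} {x₀ u : R}
    (x : Fin N → R) (hx : x₀ ^ (M + 1) = 0) (hu : u * (1 - (α + t) * x₀) = 1) :
    masterSum M t α (Fin.cons x₀ x : Fin (N + 1) → R)
      = (1 - t * x₀) * u * masterSum M t (α + α * (α + t - 1) * x₀ * u) x := by
  have key : ∀ c : Fin N → Fin (M + 1),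
      ∑ m : Fin (M + 1), x₀ ^ (m : ℕ) * MvPolynomial.coeff
        (Finsupp.equivFunOnFinite.symm fun v => ((Fin.cons m c : Fin (N + 1) → Fin (M + 1)) v : ℕ))
        (∏ w, headPow (rowForm t α w) (MvPolynomial.C t * MvPolynomial.X w)
          ((Fin.cons m c : Fin (N + 1) → Fin (M + 1)) w))
      = (1 - t * x₀) * u * MvPolynomial.coeff (Finsupp.equivFunOnFinite.symm fun v => (c v : ℕ))
        (∏ w, headPow (rowForm t (α + α * (α + t - 1) * x₀ * u) w)
          (MvPolynomial.C t * MvPolynomial.X w) (c w)) := by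
    intro c
    set F : (MvPolynomial (Fin N) R)[X] :=
      ∏ w : Fin N, headPow (C (rowForm t α w) + C (MvPolynomial.C α) * X)
        (C (MvPolynomial.C t * MvPolynomial.X w)) (c w) with hF
    have h := sum_coeff_mul_headPow (M := M) (x := (MvPolynomial.C x₀ : MvPolynomial (Fin N) R))
      (a := MvPolynomial.C (α + t - 1) * ∑ v, MvPolynomial.X v) (b := MvPolynomial.C (α + t))
      (t := MvPolynomial.C t) (u := MvPolynomial.C u)
      (by rw [← map_pow, hx, map_zero])
      (by rw [← map_mul, ← map_one MvPolynomial.C, ← map_sub, ← map_mul, hu]) F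
    have hev : F.eval (MvPolynomial.C (α + t - 1) * (∑ v, MvPolynomial.X v) * MvPolynomial.C x₀
          * MvPolynomial.C u)
        = ∏ w, headPow (rowForm t (α + α * (α + t - 1) * x₀ * u) w)
          (MvPolynomial.C t * MvPolynomial.X w) (c w) := by
      rw [hF, ← coe_evalRingHom, map_prod]
      refine Finset.prod_congr rfl fun w _ => ?_
      rw [map_headPow]
      congr 1
      · rw [rowForm_add]
        simp only [coe_evalRingHom, eval_add, eval_mul, eval_C, eval_X, map_mul]
        ring
      · simp
    rw [hev] at h
    have h' := congrArg
      (MvPolynomial.coeff (Finsupp.equivFunOnFinite.symm fun v => (c v : ℕ))) h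
    have e1 : (1 - MvPolynomial.C t * MvPolynomial.C x₀) * MvPolynomial.C u
        = (MvPolynomial.C ((1 - t * x₀) * u) : MvPolynomial (Fin N) R) := by simp
    rw [e1, MvPolynomial.coeff_C_mul, MvPolynomial.coeff_sum, Finset.sum_range] at h'
    rw [← h']
    refine Finset.sum_congr rfl fun m _ => ?_
    rw [← map_pow, MvPolynomial.coeff_C_mul]
    congr 1
    have e2 : (Finsupp.equivFunOnFinite.symm fun v : Fin (N + 1) =>
          ((Fin.cons m c : Fin (N + 1) → Fin (M + 1)) v : ℕ))
        = (Finsupp.equivFunOnFinite.symm fun v => (c v : ℕ)).cons (m : ℕ) := by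
      ext v
      refine Fin.cases ?_ (fun v => ?_) v <;> simp
    rw [e2, ← MvPolynomial.finSuccEquiv_coeff_coeff, map_prod, Fin.prod_univ_succ, mul_comm]
    congr 3
    · rw [hF]
      refine Finset.prod_congr rfl fun w _ => ?_
      rw [Fin.cons_succ, ← AlgEquiv.coe_ringEquiv, ← RingEquiv.coe_toRingHom, map_headPow]
      congr 1
      · exact finSuccEquiv_rowForm_succ t α w
      · simp [MvPolynomial.finSuccEquiv_apply]
    · rw [Fin.cons_zero, ← AlgEquiv.coe_ringEquiv, ← RingEquiv.coe_toRingHom, map_headPow]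
      congr 1
      · exact finSuccEquiv_rowForm_zero t α N
      · simp [MvPolynomial.finSuccEquiv_apply]
  unfold masterSum
  rw [← (Fin.consEquiv fun _ : Fin (N + 1) => Fin (M + 1)).sum_comp, Fintype.sum_prod_type_right,
    Finset.mul_sum]
  refine Finset.sum_congr rfl fun c _ => ?_
  rw [mul_left_comm, ← key c, Finset.mul_sum]
  refine Finset.sum_congr rfl fun m _ => ?_
  rw [Fin.prod_univ_succ]
  simp only [Fin.consEquiv_apply, Fin.cons_zero, Fin.cons_succ]
  ring

/-- `∏ (1 - t x v)`. -/
def diagProd {R : Type*} [CommRing R] (t : R) : {N : ℕ} → (Fin N → R) → R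
  | 0, _ => 1
  | _ + 1, x => (1 - t * x 0) * diagProd t (Fin.tail x)

/-- The coefficient of `-α` in the determinant `det (1 - diag(x) A(α))`. -/
def detSlope {R : Type*} [CommRing R] (t : R) : {N : ℕ} → (Fin N → R) → R
  | 0, _ => 0
  | _ + 1, x => x 0 * diagProd t (Fin.tail x) + (1 - x 0) * detSlope t (Fin.tail x)

theorem isUnit_one_sub_mul {R : Type*} [CommRing R] {M : ℕ} {x : R} (hx : x ^ (M + 1) = 0)
    (b : R) : ∃ u : R, u * (1 - b * x) = 1 := by
  have h : IsNilpotent (b * x) := ⟨M + 1, by rw [mul_pow, hx, mul_zero]⟩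
  obtain ⟨u, hu⟩ := h.isUnit_one_sub.exists_left_inv
  exact ⟨u, hu⟩

/-- If `α'` is the parameter after one elimination, then `(1 - (α + t) x 0) α' = α (1 - x 0)`. This
is the recursion defining `detSlope`, and it drives the induction on the number of variables. -/
theorem masterSum_mul_det {R : Type*} [CommRing R] {M : ℕ} (t : R) {N : ℕ} :
    ∀ (α : R) (x : Fin N → R), (∀ i, x i ^ (M + 1) = 0) →
      masterSum M t α x * (diagProd t x - α * detSlope t x) = diagProd t x := by
  induction N with
  | zero =>
    intro α x _
    simp [masterSum, diagProd, detSlope, Subsingleton.elim _ (0 : Fin 0 →₀ ℕ)]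
  | succ N ih =>
    intro α x hx
    obtain ⟨u, hu⟩ := isUnit_one_sub_mul (hx 0) (α + t)
    have h1 := masterSum_cons t α (Fin.tail x) (hx 0) hu
    rw [Fin.cons_self_tail] at h1
    have h2 := ih (α + α * (α + t - 1) * x 0 * u) (Fin.tail x) fun i => hx i.succ
    rw [h1, diagProd, detSlope]
    linear_combination (1 - t * x 0) * h2
      + (1 - t * x 0) * masterSum M t (α + α * (α + t - 1) * x 0 * u) (Fin.tail x)
        * (diagProd t (Fin.tail x) - α * detSlope t (Fin.tail x)) * hu

theorem isUnit_diagProd {R : Type*} [CommRing R] {M : ℕ} (t : R) {N : ℕ} (x : Fin N → R)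
    (hx : ∀ i, x i ^ (M + 1) = 0) : IsUnit (diagProd t x) := by
  induction N with
  | zero => exact isUnit_one
  | succ N ih =>
    obtain ⟨u, hu⟩ := isUnit_one_sub_mul (hx 0) t
    exact (IsUnit.of_mul_eq_one_right _ hu).mul (ih _ fun i => hx i.succ)

/-- `detSlope` of the tail is eliminated between the closed forms, at `α = 1`, for `x` and for its
tail. -/
theorem masterSum_functional {R : Type*} [CommRing R] {M : ℕ} (t : R) {N : ℕ}
    (x : Fin (N + 1) → R) (hx : ∀ i, x i ^ (M + 1) = 0) :
    masterSum M t 1 x * (1 - x 0 - t * x 0 * masterSum M t 1 (Fin.tail x))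
      = (1 - t * x 0) * masterSum M t 1 (Fin.tail x) := by
  have h1 := masterSum_mul_det t 1 x hx
  have h2 := masterSum_mul_det t 1 (Fin.tail x) fun i => hx i.succ
  rw [diagProd, detSlope] at h1
  refine (isUnit_diagProd t (Fin.tail x) fun i => hx i.succ).mul_left_cancel ?_
  linear_combination masterSum M t 1 (Fin.tail x) * h1 - masterSum M t 1 x * (1 - x 0) * h2

end Master

/-! ### Permutations with compatible sequences, encoded as barred words. -/

section Words

/-- The total order on the letters `(v, b)`: larger `v` first, and for the same `v` the barred
letter `(v, false)` before the unbarred letter `(v, true)`. -/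
def letterKey {N : ℕ} (k : Fin N × Bool) : (Fin N)ᵒᵈ ×ₗ Bool :=
  toLex (OrderDual.toDual k.1, k.2)

theorem letterKey_injective {N : ℕ} : Function.Injective (letterKey (N := N)) := by
  rintro ⟨a, b⟩ ⟨c, d⟩ h
  simpa [letterKey] using h

theorem letterKey_le {N : ℕ} {k l : Fin N × Bool} :
    letterKey k ≤ letterKey l ↔ l.1 < k.1 ∨ k.1 = l.1 ∧ k.2 ≤ l.2 := by
  simp [letterKey, Prod.Lex.le_iff]

/-- The stable sorting permutation of a word. -/
def wordSort {n N : ℕ} (U : Fin n → Fin N × Bool) : Equiv.Perm (Fin n) :=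
  Tuple.sort (letterKey ∘ U)

theorem eq_wordSort_iff {n N : ℕ} {U : Fin n → Fin N × Bool} {σ : Equiv.Perm (Fin n)} :
    σ = wordSort U ↔ Monotone (fun i => letterKey (U (σ i))) ∧
      ∀ i j, i < j → U (σ i) = U (σ j) → σ i < σ j := by
  unfold wordSort
  rw [Tuple.eq_sort_iff]
  simp only [Function.comp_apply, letterKey_injective.eq_iff]
  rfl

/-- A word is good if its bars mark the excedances of its sorting permutation. -/
def IsGood {n N : ℕ} (U : Fin n → Fin N × Bool) : Prop :=
  ∀ i, (U (wordSort U i)).2 = false ↔ i < wordSort U i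

/-- The sorted sequence of the values of a word. -/
def sortedValues {n N : ℕ} (U : Fin n → Fin N × Bool) (i : Fin n) : Fin N :=
  (U (wordSort U i)).1

theorem antitone_sortedValues {n N : ℕ} (U : Fin n → Fin N × Bool) :
    Antitone (sortedValues U) := by
  intro i j hij
  have h := (eq_wordSort_iff.1 (rfl : wordSort U = wordSort U)).1 hij
  simp only [letterKey_le] at h
  rcases h with h | h
  · exact h.le
  · exact h.1.ge

/-- The letters that a good word with sorted values `s` may have at the position `j`. -/
def IsAllowed {n N : ℕ} (s : Fin n → Fin N) (j : Fin n) (k : Fin N × Bool) : Prop :=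
  if k.2 = false then s j ≤ k.1 ∧ (k.1 = s j → ∃ i < j, s i = s j) else k.1 ≤ s j

/-- When the sorted values at `i` and `σ i` differ, their order decides how `i` and `σ i` compare.
Only ties need care: along a run of equal letters `σ` is increasing, so `k < σ k` propagates to the
right and `σ k ≤ k` to the left. -/
theorem isGood_iff {n N : ℕ} (U : Fin n → Fin N × Bool) :
    IsGood U ↔ ∀ j, IsAllowed (sortedValues U) j (U j) := by
  obtain ⟨hmono, htie⟩ := eq_wordSort_iff.1 (rfl : wordSort U = wordSort U)
  have hs := antitone_sortedValues U
  set σ := wordSort U with hσ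
  have hsv : ∀ i, sortedValues U i = (U (σ i)).1 := fun i => rfl
  constructor
  · intro h j
    obtain ⟨i, rfl⟩ := σ.surjective j
    unfold IsAllowed
    split_ifs with hb
    · have hi := (h i).1 hb
      refine ⟨?_, fun he => ⟨i, hi, he⟩⟩
      rw [← hsv]
      exact hs hi.le
    · have hi := mt (h i).2 hb
      rw [← hsv]
      exact hs (not_lt.1 hi)
  · intro h i
    have hA := h (σ i)
    unfold IsAllowed at hA
    constructor
    · intro hb
      rw [if_pos hb, ← hsv] at hA
      rcases hA.1.lt_or_eq with hlt | heq
      · by_contra hcon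
        exact absurd (hs (not_lt.1 hcon)) (not_le.2 hlt)
      -- The block of this value starts at some `a ≤ σ i ≤ i`. Barred letters come first in it, so
      -- positions `a` to `i` of the sorted word carry the same letter. The tie rule gives `a < σ
      -- a`, which propagates up to `i`.
      by_contra hcon
      have hne : (Finset.univ.filter fun a => sortedValues U a = sortedValues U i).Nonempty :=
        ⟨i, by simp⟩
      obtain ⟨a, ha, hmin⟩ := Finset.exists_min_image _ (fun a : Fin n => a) hne
      simp only [Finset.mem_filter, Finset.mem_univ, true_and] at ha hmin
      have hai : a ≤ σ i := hmin _ heq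
      have hblock : ∀ k, a ≤ k → k ≤ i → U (σ k) = U (σ i) := by
        intro k hak hki
        have h1 : sortedValues U k = sortedValues U i :=
          le_antisymm ((hs hak).trans ha.le) (hs hki)
        have h2 := hmono hki
        simp only [letterKey_le] at h2
        rcases h2 with h2 | h2
        · rw [← hsv, ← hsv, h1] at h2
          exact absurd h2 (lt_irrefl _)
        · refine Prod.ext h2.1 ?_
          have := h2.2
          rw [hb] at this ⊢
          exact Bool.eq_false_of_le_false this
      have haU := hblock a le_rfl (hai.trans (not_lt.1 hcon))
      have hAa := h (σ a)
      unfold IsAllowed at hAa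
      rw [haU, if_pos hb, ← hsv] at hAa
      have haσ : a < σ a := by
        rcases hAa.1.lt_or_eq with h3 | h3
        · by_contra hc
          exact absurd (hs (not_lt.1 hc)) (not_le.2 (ha ▸ h3))
        · obtain ⟨k, hk, hk'⟩ := hAa.2 h3.symm
          exact lt_of_le_of_lt (hmin _ (hk'.trans h3)) hk
      have step : ∀ d : ℕ, ∀ hd : (a : ℕ) + d < n, (a : ℕ) + d ≤ i →
          (a : ℕ) + d < σ ⟨a + d, hd⟩ := by
        intro d
        induction d with
        | zero => intro _ _; exact haσ
        | succ d ih =>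
          intro hd hdi
          have h4 := ih (by omega) (by omega)
          have h5 : σ ⟨a + d, by omega⟩ < σ ⟨a + (d + 1), hd⟩ := by
            apply htie _ _ (by simp [Fin.lt_def])
            exact (hblock ⟨a + d, by omega⟩ (by simp only [Fin.le_def]; omega)
              (by simp only [Fin.le_def]; omega)).trans
              (hblock ⟨a + (d + 1), hd⟩ (by simp only [Fin.le_def]; omega)
              (by simp only [Fin.le_def]; omega)).symm
          have h6 : ((σ ⟨a + d, by omega⟩ : Fin n) : ℕ) < σ ⟨a + (d + 1), hd⟩ := h5
          omega
      have hai' : (a : ℕ) ≤ i := hai.trans (not_lt.1 hcon)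
      have h7 := step (i - a) (by omega) (by omega)
      have h8 : (⟨a + (i - a), by omega⟩ : Fin n) = i := Fin.ext (by simp; omega)
      rw [h8] at h7
      have h9 : ((σ i : Fin n) : ℕ) ≤ i := not_lt.1 hcon
      omega
    · intro hi
      by_contra hb
      rw [if_neg hb, ← hsv] at hA
      -- The mirror argument: from `i` to the last index `b` of the block all letters are the same
      -- unbarred one, and `σ b ≤ b` propagates down to `i`.
      have heq : sortedValues U i = sortedValues U (σ i) := le_antisymm hA (hs hi.le)
      have hne : (Finset.univ.filter fun a => sortedValues U a = sortedValues U i).Nonempty :=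
        ⟨i, by simp⟩
      obtain ⟨b, hbb, hmax⟩ := Finset.exists_max_image _ (fun a : Fin n => a) hne
      simp only [Finset.mem_filter, Finset.mem_univ, true_and] at hbb hmax
      have hib : i ≤ b := hmax _ rfl
      have hblock : ∀ k, i ≤ k → k ≤ b → U (σ k) = U (σ i) := by
        intro k hik hkb
        have h1 : sortedValues U k = sortedValues U i :=
          le_antisymm (hs hik) (hbb.ge.trans (hs hkb))
        have h2 := hmono hik
        simp only [letterKey_le] at h2
        rcases h2 with h2 | h2
        · rw [← hsv, ← hsv, h1] at h2
          exact absurd h2 (lt_irrefl _)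
        · refine Prod.ext h2.1.symm ?_
          have := h2.2
          rw [Bool.eq_true_of_not_eq_false hb] at this ⊢
          exact Bool.eq_true_of_true_le this
      have hbU := hblock b hib le_rfl
      have hAb := h (σ b)
      unfold IsAllowed at hAb
      rw [hbU, if_neg hb, ← hsv] at hAb
      have hbσ : σ b ≤ b := by
        by_contra hc
        have := hs (not_le.1 hc).le
        exact hc (hmax _ (le_antisymm (this.trans hbb.le) hAb))
      have step : ∀ d : ℕ, ∀ hd : (b : ℕ) - d < n, (i : ℕ) + d ≤ b →
          (σ ⟨b - d, hd⟩ : ℕ) ≤ b - d := by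
        intro d
        induction d with
        | zero => intro _ _; exact hbσ
        | succ d ih =>
          intro hd hdi
          have h4 := ih (by omega) (by omega)
          have h5 : σ ⟨b - (d + 1), hd⟩ < σ ⟨b - d, by omega⟩ := by
            apply htie _ _ (by simp only [Fin.lt_def]; omega)
            exact (hblock ⟨b - (d + 1), hd⟩ (by simp only [Fin.le_def]; omega)
              (by simp only [Fin.le_def]; omega)).trans
              (hblock ⟨b - d, by omega⟩ (by simp only [Fin.le_def]; omega)
              (by simp only [Fin.le_def]; omega)).symm
          have h6 : (σ ⟨b - (d + 1), hd⟩ : ℕ) < (σ ⟨b - d, by omega⟩ : Fin n) := h5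
          omega
      have hib' : (i : ℕ) ≤ b := hib
      have h7 := step (b - i) (by omega) (by omega)
      have h8 : (⟨b - (b - i), by omega⟩ : Fin n) = i := Fin.ext (by simp; omega)
      rw [h8] at h7
      have h9 : (i : ℕ) < (σ i : Fin n) := hi
      omega

/-- The sequence `s` and the permutation `σ` are compatible: `s` is weakly decreasing, and strictly
so at the descents of `σ` with respect to the order that puts excedances first. -/
def IsCompatible {n N : ℕ} (σ : Equiv.Perm (Fin n)) (s : Fin n → Fin N) : Prop :=
  StrictMono fun i => toLex (OrderDual.toDual (s i), toLex (decide (¬ i < σ i), σ i))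

/-- The right side is the criterion of `eq_wordSort_iff` for the word with the letter `(s i, bar)`
at the position `σ i`, barred when `i` is an excedance. -/
theorem isCompatible_iff {n N : ℕ} (σ : Equiv.Perm (Fin n)) (s : Fin n → Fin N) :
    IsCompatible σ s ↔ Monotone (fun i => letterKey (s i, decide (¬ i < σ i))) ∧
      ∀ i j, i < j → (s i, decide (¬ i < σ i)) = (s j, decide (¬ j < σ j)) → σ i < σ j := by
  constructor
  · intro h
    refine ⟨fun i j hij => ?_, fun i j hij he => ?_⟩
    · rw [letterKey_le]
      rcases hij.lt_or_eq with hlt | rfl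
      · have := h hlt
        rw [Prod.Lex.lt_iff] at this
        rcases this with h1 | h1
        · exact Or.inl h1
        · refine Or.inr ⟨h1.1, ?_⟩
          have h2 := h1.2
          rw [Prod.Lex.lt_iff] at h2
          rcases h2 with h2 | h2
          · exact h2.le
          · exact h2.1.le
      · exact Or.inr ⟨rfl, le_rfl⟩
    · have := h hij
      rw [Prod.mk.injEq] at he
      simp only [he.1, he.2, Prod.Lex.lt_iff, ofLex_toLex, lt_irrefl, false_or, true_and] at this
      exact this
  · rintro ⟨h1, h2⟩ i j hij
    have h3 := h1 hij.le
    rw [letterKey_le] at h3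
    rw [Prod.Lex.lt_iff]
    rcases h3 with h3 | ⟨h3, h4⟩
    · exact Or.inl h3
    · refine Or.inr ⟨h3, ?_⟩
      rw [Prod.Lex.lt_iff]
      rcases h4.lt_or_eq with h5 | h5
      · exact Or.inl h5
      · exact Or.inr ⟨h5, h2 i j hij (Prod.ext h3 h5)⟩

open Classical in
-- The pair `(σ, s)` is sent to the word that puts `s i` at the position `σ i`, barred when `i < σ
-- i`. Sorting recovers the pair, and goodness says that the bars are the right ones.
theorem sum_isCompatible_eq_sum_isGood {Λ : Type*} [CommRing Λ] {n N : ℕ} (t : Λ)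
    (x : Fin N → Λ) :
    ∑ σ : Equiv.Perm (Fin n), t ^ exc σ *
        ∑ s ∈ Finset.univ.filter (fun s : Fin n → Fin N => IsCompatible σ s), ∏ i, x (s i)
      = ∑ U ∈ Finset.univ.filter (fun U : Fin n → Fin N × Bool => IsGood U),
        ∏ j, (x (U j).1 * if (U j).2 = false then t else 1) := by
  simp only [Finset.mul_sum]
  rw [Finset.sum_sigma']
  refine Finset.sum_bij'
    (fun p _ j => (p.2 (p.1.symm j), decide (¬ p.1.symm j < j)))
    (fun U _ => ⟨wordSort U, sortedValues U⟩) ?_ ?_ ?_ ?_ ?_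
  · rintro ⟨σ, s⟩ h
    simp only [Finset.mem_sigma, Finset.mem_univ, Finset.mem_filter, true_and] at h ⊢
    have hσ : σ = wordSort (fun j => (s (σ.symm j), decide (¬ σ.symm j < j))) := by
      rw [eq_wordSort_iff]
      simpa using (isCompatible_iff σ s).1 h
    unfold IsGood
    rw [← hσ]
    intro i
    simp
  · intro U h
    simp only [Finset.mem_sigma, Finset.mem_univ, Finset.mem_filter, true_and] at h ⊢
    rw [isCompatible_iff]
    have hU : ∀ i, (sortedValues U i, decide (¬ i < wordSort U i)) = U (wordSort U i) := by
      intro i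
      refine Prod.ext rfl ?_
      have := h i
      cases hb : (U (wordSort U i)).2 <;> simp_all
    simp only [hU]
    exact eq_wordSort_iff.1 rfl
  · rintro ⟨σ, s⟩ h
    simp only [Finset.mem_sigma, Finset.mem_univ, Finset.mem_filter, true_and] at h
    have hσ : σ = wordSort (fun j => (s (σ.symm j), decide (¬ σ.symm j < j))) := by
      rw [eq_wordSort_iff]
      simpa using (isCompatible_iff σ s).1 h
    have hs : sortedValues (fun j => (s (σ.symm j), decide (¬ σ.symm j < j))) = s := by
      funext i
      unfold sortedValues
      rw [← hσ]
      simp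
    simp only [← hσ, hs]
  · intro U h
    simp only [Finset.mem_filter, Finset.mem_univ, true_and] at h
    funext j
    refine Prod.ext ?_ ?_
    · simp [sortedValues]
    · have := h ((wordSort U).symm j)
      simp only [Equiv.apply_symm_apply] at this
      cases hb : (U j).2 <;> simp_all
  · rintro ⟨σ, s⟩ h
    rw [← Equiv.prod_comp σ fun j => x (s (σ.symm j)) *
      if decide (¬ σ.symm j < j) = false then t else 1]
    simp only [Equiv.symm_apply_apply, Finset.prod_mul_distrib]
    rw [mul_comm]
    congr 1
    rw [Finset.prod_ite]
    simp [exc]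

end Words

/-! ### Counting good words of given content by products of linear forms. -/

section Content

/-- The number of occurrences of `v` in the sequence `f`. -/
def content {n N : ℕ} (f : Fin n → Fin N) (v : Fin N) : ℕ :=
  (Finset.univ.filter fun j => f j = v).card

theorem content_comp_perm {n N : ℕ} (f : Fin n → Fin N) (σ : Equiv.Perm (Fin n)) :
    content (f ∘ σ) = content f := by
  funext v
  unfold content
  refine Finset.card_bij (fun j _ => σ j) ?_ (fun _ _ _ _ h => σ.injective h) ?_
  · simp
  · intro j hj
    exact ⟨σ.symm j, by simpa using hj, by simp⟩

theorem sum_content {n N : ℕ} (f : Fin n → Fin N) : ∑ v, content f v = n := by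
  have := Finset.card_eq_sum_card_fiberwise (f := f) (s := Finset.univ) (t := Finset.univ)
    (fun _ _ => Finset.mem_univ _)
  simpa [content] using this.symm

theorem content_sortedValues {n N : ℕ} (U : Fin n → Fin N × Bool) :
    content (sortedValues U) = content fun j => (U j).1 :=
  content_comp_perm (fun j => (U j).1) (wordSort U)

/-- For weakly decreasing `f`, `a ≤ f j` holds exactly when `j` is smaller than the number of
entries that are at least `a`, and this number depends only on the content. -/
theorem eq_of_antitone_of_content_eq {n N : ℕ} {f g : Fin n → Fin N} (hf : Antitone f)
    (hg : Antitone g) (h : content f = content g) : f = g := by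
  have hcard : ∀ (f : Fin n → Fin N) (a : Fin N),
      (Finset.univ.filter fun i => (OrderDual.toDual ∘ f) i ≤ OrderDual.toDual a).card
        = ∑ v ∈ Finset.univ.filter (fun v => a ≤ v), content f v := by
    intro f a
    rw [Finset.card_eq_sum_card_fiberwise (f := f) (t := Finset.univ.filter fun v => a ≤ v)]
    · refine Finset.sum_congr rfl fun v hv => ?_
      unfold content
      congr 1
      ext j
      simp only [Finset.mem_filter, Finset.mem_univ, true_and] at hv ⊢
      constructor
      · exact fun hj => hj.2
      · rintro rfl
        exact ⟨hv, rfl⟩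
    · intro j hj
      simpa using hj
  have key : ∀ j a, a ≤ f j ↔ a ≤ g j := by
    intro j a
    have h1 := Tuple.lt_card_le_iff_apply_le_of_monotone (f := OrderDual.toDual ∘ f) (j := j)
      (a := OrderDual.toDual a) (h_sorted := hf.dual_right)
    have h2 := Tuple.lt_card_le_iff_apply_le_of_monotone (f := OrderDual.toDual ∘ g) (j := j)
      (a := OrderDual.toDual a) (h_sorted := hg.dual_right)
    rw [hcard] at h1 h2
    rw [h] at h1
    exact h1.symm.trans h2
  funext j
  exact le_antisymm ((key j _).1 le_rfl) ((key j _).2 le_rfl)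

theorem exists_antitone_content {n N : ℕ} (c : Fin N → ℕ) (hc : ∑ v, c v = n) :
    ∃ s : Fin n → Fin N, Antitone s ∧ content s = c := by
  -- Any word of this content will do, since sorting it gives `s`; the bars play no role.
  have e : Fin n ≃ Σ v, Fin (c v) := Fintype.equivOfCardEq (by simp [hc])
  let U : Fin n → Fin N × Bool := fun j => ((e j).1, false)
  refine ⟨sortedValues U, antitone_sortedValues U, ?_⟩
  rw [content_sortedValues]
  funext v
  unfold content
  have : (Finset.univ.filter fun j => (U j).1 = v).card
      = (Finset.univ : Finset (Fin (c v))).card := by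
    refine (Finset.card_bij (fun a _ => e.symm ⟨v, a⟩) ?_ ?_ ?_).symm
    · simp [U]
    · intro a _ b _ h
      simpa using h
    · intro j hj
      simp only [Finset.mem_filter, Finset.mem_univ, true_and, U] at hj
      subst hj
      exact ⟨(e j).2, Finset.mem_univ _, by simp⟩
  rw [this, Finset.card_univ, Fintype.card_fin]

theorem coeff_prod_C_mul_X {Λ : Type*} [CommRing Λ] {n N : ℕ} (a : Fin n → Λ)
    (f : Fin n → Fin N) (c : Fin N → ℕ) :
    MvPolynomial.coeff (Finsupp.equivFunOnFinite.symm c)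
      (∏ j, (MvPolynomial.C (a j) * MvPolynomial.X (f j)))
      = if content f = c then ∏ j, a j else 0 := by
  have h : ∏ j, (MvPolynomial.C (a j) * MvPolynomial.X (f j) : MvPolynomial (Fin N) Λ)
      = MvPolynomial.monomial (Finsupp.equivFunOnFinite.symm (content f)) (∏ j, a j) := by
    rw [Finset.prod_mul_distrib, ← map_prod, MvPolynomial.monomial_eq]
    congr 1
    rw [Finsupp.prod_fintype _ _ (by simp), ← Finset.prod_fiberwise _ f]
    refine Finset.prod_congr rfl fun v _ => ?_
    rw [Finset.prod_congr rfl (g := fun _ => MvPolynomial.X v)]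
    · simp [content]
    · intro j hj
      rw [(Finset.mem_filter.1 hj).2]
  rw [h, MvPolynomial.coeff_monomial]
  simp only [EmbeddingLike.apply_eq_iff_eq]

open Classical in
-- A value below `s j` occurs unbarred only and a value above it barred only. The value `s j` itself
-- occurs in both ways, except that the barred one is excluded at the first position of its block.
theorem sum_isAllowed_linear {Λ : Type*} [CommRing Λ] {n N : ℕ} (t : Λ) (s : Fin n → Fin N)
    (j : Fin n) :
    ∑ k : Fin N × Bool, MvPolynomial.C (if IsAllowed s j k then
        (if k.2 = false then t else 1) else 0) * MvPolynomial.X k.1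
      = rowForm t 1 (s j)
        - if ∃ i < j, s i = s j then 0 else MvPolynomial.C t * MvPolynomial.X (s j) := by
  rw [Fintype.sum_prod_type]
  have h2 : (if ∃ i < j, s i = s j then (0 : MvPolynomial (Fin N) Λ)
      else MvPolynomial.C t * MvPolynomial.X (s j))
      = ∑ v, if v = s j then (if ∃ i < j, s i = s j then (0 : MvPolynomial (Fin N) Λ)
      else MvPolynomial.C t * MvPolynomial.X v) else 0 := by
    simp
  rw [h2, rowForm, ← Finset.sum_sub_distrib]
  refine Finset.sum_congr rfl fun v _ => ?_
  rw [Fintype.sum_bool]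
  unfold IsAllowed
  rcases lt_trichotomy v (s j) with h | h | h
  · simp [h, h.le, not_le.2 h, h.ne]
  · subst h
    by_cases hf : ∃ i < j, s i = s j
    · simp [hf, add_mul]
    · simp [hf]
      ring
  · simp [h.le, not_le.2 h, h.ne', not_lt.2 h.le]

open Classical in
theorem prod_rowForm_sub {Λ : Type*} [CommRing Λ] {n N : ℕ} (t : Λ) (s : Fin n → Fin N) :
    ∏ j, (rowForm t 1 (s j)
        - if ∃ i < j, s i = s j then 0 else MvPolynomial.C t * MvPolynomial.X (s j))
      = ∏ w, headPow (rowForm t 1 w) (MvPolynomial.C t * MvPolynomial.X w) (content s w) := by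
  rw [← Finset.prod_fiberwise _ s]
  refine Finset.prod_congr rfl fun w _ => ?_
  rcases Finset.eq_empty_or_nonempty (Finset.univ.filter fun j => s j = w) with he | hne
  · simp [content, he, headPow]
  · obtain ⟨a, ha, hmin⟩ := Finset.exists_min_image _ (fun a : Fin n => a) hne
    rw [← Finset.mul_prod_erase _ _ ha]
    have hcard : content s w = ((Finset.univ.filter fun j => s j = w).erase a).card + 1 := by
      rw [Finset.card_erase_add_one ha, content]
    rw [hcard, headPow]
    simp only [Finset.mem_filter, Finset.mem_univ, true_and] at ha hmin
    congr 1
    · rw [if_neg, ha]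
      rintro ⟨i, hi, hi'⟩
      exact absurd (hmin i (hi'.trans ha)) (not_le.2 hi)
    · rw [Finset.prod_congr rfl (g := fun _ => rowForm t 1 w), Finset.prod_const]
      intro j hj
      simp only [Finset.mem_erase, Finset.mem_filter, Finset.mem_univ, true_and] at hj
      rw [if_pos, sub_zero, hj.2]
      exact ⟨a, lt_of_le_of_ne (hmin j hj.2) (Ne.symm hj.1), ha.trans hj.2.symm⟩

open Classical in
-- The content fixes the sorted sequence `s`, so goodness becomes an independent condition at each
-- position. Expanding the product of the linear forms of the allowed letters lists exactly the good
-- words.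
theorem sum_isGood {Λ : Type*} [CommRing Λ] {n N : ℕ} (t : Λ) (x : Fin N → Λ) :
    ∑ U ∈ Finset.univ.filter (fun U : Fin n → Fin N × Bool => IsGood U),
        ∏ j, (x (U j).1 * if (U j).2 = false then t else 1)
      = ∑ c ∈ Finset.piAntidiag (Finset.univ : Finset (Fin N)) n, (∏ v, x v ^ c v) *
        MvPolynomial.coeff (Finsupp.equivFunOnFinite.symm c)
          (∏ w, headPow (rowForm t 1 w) (MvPolynomial.C t * MvPolynomial.X w) (c w)) := by
  rw [← Finset.sum_fiberwise_of_maps_to (g := fun U => content fun j => (U j).1)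
    (t := Finset.piAntidiag (Finset.univ : Finset (Fin N)) n)]
  swap
  · intro U _
    simp [Finset.mem_piAntidiag, sum_content]
  refine Finset.sum_congr rfl fun c hc => ?_
  have hc' : ∑ v, c v = n := by simpa using (Finset.mem_piAntidiag.1 hc).1
  obtain ⟨s, hs, rfl⟩ := exists_antitone_content c hc'
  have hprod : (∏ w, headPow (rowForm t 1 w) (MvPolynomial.C t * MvPolynomial.X w) (content s w))
      = ∑ U : Fin n → Fin N × Bool, ∏ j, (MvPolynomial.C (if IsAllowed s j (U j) then
        (if (U j).2 = false then t else 1) else 0) * MvPolynomial.X (U j).1) := by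
    rw [← prod_rowForm_sub]
    simp only [← sum_isAllowed_linear]
    rw [Finset.prod_univ_sum, Fintype.piFinset_univ]
  rw [hprod, MvPolynomial.coeff_sum]
  simp only [coeff_prod_C_mul_X]
  rw [Finset.mul_sum, Finset.filter_filter, Finset.sum_filter]
  refine Finset.sum_congr rfl fun U _ => ?_
  by_cases hU : content (fun j => (U j).1) = content s
  · have hsU : sortedValues U = s :=
      eq_of_antitone_of_content_eq (antitone_sortedValues U) hs
        ((content_sortedValues U).trans hU)
    rw [if_pos hU, isGood_iff, hsU]
    have hx : ∏ v, x v ^ content s v = ∏ j, x (U j).1 := by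
      rw [← Finset.prod_fiberwise _ fun j => (U j).1]
      refine Finset.prod_congr rfl fun v _ => ?_
      rw [Finset.prod_congr rfl (g := fun _ => x v), Finset.prod_const, ← hU, content]
      intro j hj
      rw [(Finset.mem_filter.1 hj).2]
    by_cases hall : ∀ j, IsAllowed s j (U j)
    · rw [if_pos ⟨hall, hU⟩, Finset.prod_mul_distrib, hx]
      simp only [hall, if_true]
    · rw [if_neg fun h => hall h.1]
      push Not at hall
      obtain ⟨j, hj⟩ := hall
      rw [Finset.prod_eq_zero (Finset.mem_univ j) (if_neg hj), mul_zero]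
  · rw [if_neg fun h => hU h.2, if_neg hU, mul_zero]

end Content

/-! ### Excedance-first descents and the generating function of compatible sequences. -/

section DEX

/-- `σ` has a descent at `i` with respect to the order on letters that puts the letters of the
excedances before all others. -/
def IsDex {n : ℕ} (σ : Equiv.Perm (Fin n)) (i : Fin n) : Prop :=
  ∃ h : (i : ℕ) + 1 < n,
    toLex (decide (¬ (⟨i + 1, h⟩ : Fin n) < σ ⟨i + 1, h⟩), σ ⟨i + 1, h⟩)
      < toLex (decide (¬ i < σ i), σ i)

theorem sum_mul_sub_succ (e : ℕ → ℤ) (m : ℕ) :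
    ∑ i ∈ Finset.range m, ((i : ℤ) + 1) * (e i - e (i + 1))
      = ∑ i ∈ Finset.range m, e i - m * e m := by
  induction m with
  | zero => simp
  | succ m ih =>
    rw [Finset.sum_range_succ, ih, Finset.sum_range_succ]
    push_cast
    ring

open Classical in
-- With `e` the indicator of excedances, the indicators of `IsDescent` and `IsDex` at `i` differ by
-- `e i - e (i + 1)`. If just one of `i`, `i + 1` is an excedance, it also has the larger image.
-- Abel summation then leaves `exc σ`.
theorem sum_isDex_add_exc {n : ℕ} (σ : Equiv.Perm (Fin n)) :
    ∑ i : Fin n, (if IsDex σ i then (i : ℕ) + 1 else 0) + exc σ = maj σ := by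
  set e : ℕ → ℤ := fun k => if h : k < n then (if (⟨k, h⟩ : Fin n) < σ ⟨k, h⟩ then 1 else 0) else 0
    with he
  have hval : ∀ i : Fin n, e i = if i < σ i then 1 else 0 := fun i => by simp [he]
  have hlast : e n = 0 := by simp [he]
  have hpt : ∀ i : Fin n, ((if IsDescent σ i then (i : ℤ) + 1 else 0)
      - (if IsDex σ i then (i : ℤ) + 1 else 0)) = ((i : ℤ) + 1) * (e i - e (i + 1)) := by
    intro i
    by_cases h : (i : ℕ) + 1 < n
    · have h1 := hval ⟨i + 1, h⟩
      simp only at h1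
      rw [h1, hval]
      have hne : σ i ≠ σ ⟨i + 1, h⟩ := by
        intro hh
        have := congrArg Fin.val (σ.injective hh)
        simp at this
      have hne' : (σ i : ℕ) ≠ σ ⟨i + 1, h⟩ := fun hh => hne (Fin.ext hh)
      have hdes : IsDescent σ i ↔ σ ⟨i + 1, h⟩ < σ i := ⟨fun ⟨_, h⟩ => h, fun h' => ⟨h, h'⟩⟩
      have hdex : IsDex σ i ↔ toLex (decide (¬ (⟨i + 1, h⟩ : Fin n) < σ ⟨i + 1, h⟩), σ ⟨i + 1, h⟩)
          < toLex (decide (¬ i < σ i), σ i) := ⟨fun ⟨_, h⟩ => h, fun h' => ⟨h, h'⟩⟩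
      simp only [hdes, hdex, Prod.Lex.lt_iff, ofLex_toLex]
      by_cases hi : i < σ i <;> by_cases hj : (⟨i + 1, h⟩ : Fin n) < σ ⟨i + 1, h⟩
      · simp [hi, hj]
      · have : σ ⟨i + 1, h⟩ < σ i := by
          simp only [Fin.lt_def, not_lt] at hi hj ⊢
          omega
        simp [hi, hj, this]
      · have : ¬ σ ⟨i + 1, h⟩ < σ i := by
          simp only [Fin.lt_def, not_lt] at hi hj ⊢
          omega
        simp [hi, hj, this]
      · simp [hi, hj]
    · have hi : (i : ℕ) + 1 = n := by omega
      have h1 : ¬ IsDescent σ i := fun ⟨h', _⟩ => h h'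
      have h2 : ¬ IsDex σ i := fun ⟨h', _⟩ => h h'
      have h3 : ¬ i < σ i := by
        simp only [Fin.lt_def]
        omega
      rw [hi, hlast, hval]
      simp [h1, h2, h3]
  have hsum := Finset.sum_congr rfl fun i (_ : i ∈ (Finset.univ : Finset (Fin n))) => hpt i
  rw [Finset.sum_sub_distrib, ← Finset.sum_range (fun i => ((i : ℤ) + 1) * (e i - e (i + 1))),
    sum_mul_sub_succ, hlast, mul_zero, sub_zero, Finset.sum_range] at hsum
  have hexc : ∑ i : Fin n, e i = exc σ := by
    simp [hval, exc]
  have hmaj : (∑ i : Fin n, if IsDescent σ i then (i : ℤ) + 1 else 0) = maj σ := by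
    simp [maj, Finset.sum_filter]
  rw [hexc, hmaj] at hsum
  zify
  linarith

theorem strictMono_fin_iff {α : Type*} [Preorder α] {n : ℕ} {f : Fin n → α} :
    StrictMono f ↔ ∀ (i : Fin n) (h : (i : ℕ) + 1 < n), f i < f ⟨i + 1, h⟩ := by
  cases n with
  | zero => exact ⟨fun _ i => i.elim0, fun _ i => i.elim0⟩
  | succ n =>
    rw [Fin.strictMono_iff_lt_succ]
    constructor
    · intro h i hi
      exact h ⟨i, by omega⟩
    · intro h i
      exact h i.castSucc (by simp)

/-- A strictly monotone map into the lexicographic order need only be checked on neighbours, where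
the second component breaks ties. -/
theorem isCompatible_iff_isDex {n N : ℕ} (σ : Equiv.Perm (Fin n)) (s : Fin n → Fin N) :
    IsCompatible σ s ↔ ∀ (i : Fin n) (h : (i : ℕ) + 1 < n),
      s ⟨i + 1, h⟩ ≤ s i ∧ (IsDex σ i → s ⟨i + 1, h⟩ < s i) := by
  unfold IsCompatible
  rw [strictMono_fin_iff]
  refine forall_congr' fun i => forall_congr' fun h => ?_
  have hne : toLex (decide (¬ (⟨i + 1, h⟩ : Fin n) < σ ⟨i + 1, h⟩), σ ⟨i + 1, h⟩)
      ≠ toLex (decide (¬ i < σ i), σ i) := by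
    intro hh
    have h1 := congrArg (fun p => (ofLex p).2) hh
    have := congrArg Fin.val (σ.injective h1)
    simp at this
  have hdex : IsDex σ i ↔ toLex (decide (¬ (⟨i + 1, h⟩ : Fin n) < σ ⟨i + 1, h⟩), σ ⟨i + 1, h⟩)
      < toLex (decide (¬ i < σ i), σ i) := ⟨fun ⟨_, h⟩ => h, fun h' => ⟨h, h'⟩⟩
  rw [Prod.Lex.lt_iff, hdex]
  simp only [ofLex_toLex, OrderDual.toDual_lt_toDual, OrderDual.toDual_inj]
  constructor
  · rintro (h1 | ⟨h1, h2⟩)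
    · exact ⟨h1.le, fun _ => h1⟩
    · exact ⟨h1.ge, fun h3 => absurd h3 h2.asymm⟩
  · rintro ⟨h1, h2⟩
    rcases h1.lt_or_eq with h3 | h3
    · exact Or.inl h3
    · refine Or.inr ⟨h3.symm, lt_of_not_ge fun h4 => ?_⟩
      exact absurd (h2 (lt_of_le_of_ne h4 hne)) (by rw [h3]; exact lt_irrefl _)

/-- The partial sums, from the right, of a sequence. -/
def tailSum {n : ℕ} (e : Fin n → ℕ) (i : Fin n) : ℕ :=
  ∑ j, if i ≤ j then e j else 0

theorem tailSum_succ {n : ℕ} (e : Fin n → ℕ) (i : Fin n) (h : (i : ℕ) + 1 < n) :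
    tailSum e i = e i + tailSum e ⟨i + 1, h⟩ := by
  have h1 : e i = ∑ j, if j = i then e j else 0 := by simp
  unfold tailSum
  rw [h1, ← Finset.sum_add_distrib]
  refine Finset.sum_congr rfl fun j _ => ?_
  simp only [Fin.le_def, Fin.ext_iff]
  split_ifs <;> omega

theorem tailSum_last {n : ℕ} (e : Fin n → ℕ) (i : Fin n) (h : (i : ℕ) + 1 = n) :
    tailSum e i = e i := by
  have h1 : e i = ∑ j, if j = i then e j else 0 := by simp
  unfold tailSum
  rw [h1]
  refine Finset.sum_congr rfl fun j _ => ?_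
  simp only [Fin.le_def, Fin.ext_iff]
  split_ifs <;> omega

theorem sum_tailSum {n : ℕ} (e : Fin n → ℕ) :
    ∑ i, tailSum e i = ∑ j : Fin n, ((j : ℕ) + 1) * e j := by
  unfold tailSum
  rw [Finset.sum_comm]
  refine Finset.sum_congr rfl fun j _ => ?_
  rw [← Finset.sum_filter, Finset.sum_const, smul_eq_mul]
  congr 1
  rw [← Fin.card_Iic j]
  congr 1
  ext i
  simp

theorem tailSum_injective {n : ℕ} : Function.Injective (tailSum (n := n)) := by
  intro e f hef
  funext i
  have h0 := congrFun hef i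
  by_cases h : (i : ℕ) + 1 < n
  · rw [tailSum_succ e i h, tailSum_succ f i h, hef] at h0
    omega
  · rwa [tailSum_last e i (by omega), tailSum_last f i (by omega)] at h0

theorem tailSum_sub {n : ℕ} (s : Fin n → ℕ)
    (hs : ∀ (i : Fin n) (h : (i : ℕ) + 1 < n), s ⟨i + 1, h⟩ ≤ s i) :
    tailSum (fun i => s i - if h : (i : ℕ) + 1 < n then s ⟨i + 1, h⟩ else 0) = s := by
  have key : ∀ d : ℕ, ∀ i : Fin n, (i : ℕ) + 1 + d = n →
      tailSum (fun i => s i - if h : (i : ℕ) + 1 < n then s ⟨i + 1, h⟩ else 0) i = s i := by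
    intro d
    induction d with
    | zero =>
      intro i hi
      rw [tailSum_last _ _ (by omega), dif_neg (by omega), Nat.sub_zero]
    | succ d ih =>
      intro i hi
      have h : (i : ℕ) + 1 < n := by omega
      rw [tailSum_succ _ i h, ih ⟨i + 1, h⟩ (by simp only; omega), dif_pos h]
      have := hs i h
      omega
  funext i
  exact key (n - 1 - i) i (by omega)

open Classical in
-- The successive drops of a compatible sequence are `g + d`, with `g` arbitrary and `d` the
-- indicator of `IsDex`. The sum of the sequence is therefore `maj - exc` plus `∑ (j + 1) g j`, and
-- summing over `g` gives geometric series. The bound `N` on the entries only costs multiples of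
-- `q^N`.
theorem dvd_prod_mul_sum_compatible {Λ : Type*} [CommRing Λ] (q : Λ) (n N : ℕ)
    (σ : Equiv.Perm (Fin n)) :
    q ^ N ∣ (∏ i : Fin n, (1 - q ^ ((i : ℕ) + 1))) *
        (∑ s ∈ Finset.univ.filter (fun s : Fin n → Fin N => IsCompatible σ s),
          ∏ i, q ^ (s i : ℕ)) - q ^ (maj σ - exc σ) := by
  set d : Fin n → ℕ := fun i => if IsDex σ i then 1 else 0 with hd
  have hmaj : maj σ - exc σ = ∑ j : Fin n, ((j : ℕ) + 1) * d j := by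
    have h1 := sum_isDex_add_exc σ
    have h2 : ∑ i : Fin n, (if IsDex σ i then (i : ℕ) + 1 else 0)
        = ∑ j : Fin n, ((j : ℕ) + 1) * d j :=
      Finset.sum_congr rfl fun i _ => by simp [hd]
    omega
  have hdlast : ∀ i : Fin n, ¬ (i : ℕ) + 1 < n → d i = 0 := by
    intro i hi
    simp only [hd]
    rw [if_neg]
    rintro ⟨h, _⟩
    exact hi h
  set T : (Fin n → Fin N) → Fin n → ℕ := fun g => tailSum fun j => (g j : ℕ) + d j with hT
  have hTsum : ∀ g, ∏ i, q ^ T g i = q ^ (maj σ - exc σ) *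
      ∏ j : Fin n, (q ^ ((j : ℕ) + 1)) ^ (g j : ℕ) := by
    intro g
    rw [Finset.prod_pow_eq_pow_sum, hT, sum_tailSum, hmaj]
    simp only [mul_add, Finset.sum_add_distrib, ← pow_mul, Finset.prod_pow_eq_pow_sum]
    rw [pow_add, mul_comm]
  have hbox : (∏ i : Fin n, (1 - q ^ ((i : ℕ) + 1))) * ∑ g : Fin n → Fin N, ∏ i, q ^ T g i
      = q ^ (maj σ - exc σ) * ∏ i : Fin n, (1 - (q ^ ((i : ℕ) + 1)) ^ N) := by
    simp only [hTsum]
    rw [← Finset.mul_sum, mul_left_comm]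
    congr 1
    have := Finset.prod_univ_sum (fun _ : Fin n => (Finset.univ : Finset (Fin N)))
      (fun j v => (q ^ ((j : ℕ) + 1)) ^ (v : ℕ))
    rw [Fintype.piFinset_univ] at this
    rw [← this, ← Finset.prod_mul_distrib]
    refine Finset.prod_congr rfl fun j _ => ?_
    rw [← Finset.sum_range (fun v => (q ^ ((j : ℕ) + 1)) ^ v)]
    exact mul_neg_geom_sum _ _
  have hone : q ^ N ∣ ∏ i : Fin n, (1 - (q ^ ((i : ℕ) + 1)) ^ N) - 1 := by
    rw [← Ideal.mem_span_singleton, ← Ideal.Quotient.eq, map_prod, map_one]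
    refine Finset.prod_eq_one fun i _ => ?_
    rw [← map_one (Ideal.Quotient.mk (Ideal.span {q ^ N})), Ideal.Quotient.eq,
      Ideal.mem_span_singleton]
    refine ⟨- q ^ ((i : ℕ) * N), ?_⟩
    ring
  have hsplit := Finset.sum_filter_add_sum_filter_not (Finset.univ : Finset (Fin n → Fin N))
    (fun g => ∀ i, T g i < N) (fun g => ∏ i, q ^ T g i)
  have hrest : q ^ N ∣ ∑ g ∈ Finset.univ.filter (fun g : Fin n → Fin N => ¬ ∀ i, T g i < N),
      ∏ i, q ^ T g i := by
    refine Finset.dvd_sum fun g hg => ?_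
    simp only [Finset.mem_filter, Finset.mem_univ, true_and, not_forall, not_lt] at hg
    obtain ⟨i, hi⟩ := hg
    exact (pow_dvd_pow q hi).trans (Finset.dvd_prod_of_mem _ (Finset.mem_univ i))
  have hmain : ∑ g ∈ Finset.univ.filter (fun g : Fin n → Fin N => ∀ i, T g i < N),
      ∏ i, q ^ T g i
      = ∑ s ∈ Finset.univ.filter (fun s : Fin n → Fin N => IsCompatible σ s),
          ∏ i, q ^ (s i : ℕ) := by
    refine Finset.sum_bij
      (fun g hg i => (⟨T g i, (Finset.mem_filter.1 hg).2 i⟩ : Fin N)) ?_ ?_ ?_ ?_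
    · intro g hg
      simp only [Finset.mem_filter, Finset.mem_univ, true_and]
      rw [isCompatible_iff_isDex]
      intro i h
      have h1 := tailSum_succ (fun j => (g j : ℕ) + d j) i h
      simp only [Fin.le_def, Fin.lt_def, hT]
      refine ⟨by omega, fun h2 => ?_⟩
      have : d i = 1 := by simp [hd, h2]
      omega
    · intro g hg g' hg' h
      have h1 : T g = T g' := by
        funext i
        exact congrArg Fin.val (congrFun h i)
      have h2 := tailSum_injective h1
      funext i
      have := congrFun h2 i
      exact Fin.ext (by omega)
    · intro s hs
      simp only [Finset.mem_filter, Finset.mem_univ, true_and] at hs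
      rw [isCompatible_iff_isDex] at hs
      -- The preimage of `s` is its sequence of drops, with `0` after the last entry, diminished by
      -- `d`.
      have hN : ∀ i : Fin n, ((s i : ℕ) - (if h : (i : ℕ) + 1 < n then (s ⟨i + 1, h⟩ : ℕ) else 0))
          - d i < N := by
        intro i
        have := (s i).isLt
        omega
      have hT' : T (fun i => ⟨_, hN i⟩) = fun i => (s i : ℕ) := by
        rw [← tailSum_sub (fun i => (s i : ℕ)) fun i h => (hs i h).1, hT]
        simp only
        congr 1
        funext i
        by_cases h : (i : ℕ) + 1 < n
        · have h3 := hs i h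
          simp only [dif_pos h]
          by_cases hx : IsDex σ i
          · have h4 : (s ⟨i + 1, h⟩ : ℕ) < s i := h3.2 hx
            have : d i = 1 := by simp [hd, hx]
            omega
          · have : d i = 0 := by simp [hd, hx]
            omega
        · rw [hdlast i h]
          omega
      refine ⟨fun i => ⟨_, hN i⟩, ?_, ?_⟩
      · simp only [Finset.mem_filter, Finset.mem_univ, true_and]
        rw [hT']
        exact fun i => (s i).isLt
      · funext i
        exact Fin.ext (congrFun hT' i)
    · intro g hg
      rfl
  rw [← hmain]
  rw [← hsplit, mul_add] at hbox
  obtain ⟨r, hr⟩ := hrest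
  obtain ⟨r', hr'⟩ := hone
  refine ⟨q ^ (maj σ - exc σ) * r' - (∏ i : Fin n, (1 - q ^ ((i : ℕ) + 1))) * r, ?_⟩
  rw [hr] at hbox
  linear_combination hbox + q ^ (maj σ - exc σ) * hr'

/-- The generating function of the pairs of a permutation of `n` letters and a compatible sequence
of nonnegative integers smaller than `N`. -/
noncomputable def boundedGF {Λ : Type*} [CommRing Λ] (t q : Λ) (N n : ℕ) : Λ :=
  ∑ c ∈ Finset.piAntidiag (Finset.univ : Finset (Fin N)) n, (∏ v : Fin N, (q ^ (v : ℕ)) ^ c v) *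
    MvPolynomial.coeff (Finsupp.equivFunOnFinite.symm c)
      (∏ w, headPow (rowForm t 1 w) (MvPolynomial.C t * MvPolynomial.X w) (c w))

theorem dvd_prod_mul_boundedGF {Λ : Type*} [CommRing Λ] (t q : Λ) (N n : ℕ) :
    q ^ N ∣ (∏ i : Fin n, (1 - q ^ ((i : ℕ) + 1))) * boundedGF t q N n
      - ∑ σ : Equiv.Perm (Fin n), t ^ exc σ * q ^ (maj σ - exc σ) := by
  classical
  unfold boundedGF
  rw [← sum_isGood, ← sum_isCompatible_eq_sum_isGood t (fun v : Fin N => q ^ (v : ℕ)), Finset.mul_sum, ← Finset.sum_sub_distrib]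
  refine Finset.dvd_sum fun σ _ => ?_
  obtain ⟨r, hr⟩ := dvd_prod_mul_sum_compatible q n N σ
  refine ⟨t ^ exc σ * r, ?_⟩
  linear_combination t ^ exc σ * hr

end DEX

/-! ### The recurrence of the `q`-Eulerian polynomials. -/

section Recurrence

theorem map_rowForm {R S : Type*} [CommRing R] [CommRing S] (f : R →+* S) (t α : R) {N : ℕ}
    (w : Fin N) : MvPolynomial.map f (rowForm t α w) = rowForm (f t) (f α) w := by
  simp only [rowForm, map_sum, map_mul, MvPolynomial.map_C, MvPolynomial.map_X]
  refine Finset.sum_congr rfl fun v _ => ?_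
  congr 2
  split_ifs <;> simp

theorem map_boundedGF {R S : Type*} [CommRing R] [CommRing S] (f : R →+* S) (t q : R) (N n : ℕ) :
    f (boundedGF t q N n) = boundedGF (f t) (f q) N n := by
  simp only [boundedGF, map_sum, map_mul, map_prod, map_pow]
  refine Finset.sum_congr rfl fun c _ => ?_
  rw [← MvPolynomial.coeff_map, map_prod]
  congr 2
  refine Finset.prod_congr rfl fun w _ => ?_
  rw [map_headPow, map_rowForm, map_mul, MvPolynomial.map_C, MvPolynomial.map_X, map_one]

/-- The variable `z` marks the length of the word. Contents of total size above `M` vanish with `z ^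
(M + 1)`, so bounding each entry by `M` loses nothing. -/
theorem masterSum_geometric {R : Type*} [CommRing R] {M : ℕ} (t q : R) (N : ℕ) {z : R}
    (hz : z ^ (M + 1) = 0) :
    masterSum M t 1 (fun v : Fin N => z * q ^ (v : ℕ))
      = ∑ n ∈ Finset.range (M + 1), z ^ n * boundedGF t q N n := by
  unfold masterSum boundedGF
  set K : (Fin N → ℕ) → R := fun c => MvPolynomial.coeff (Finsupp.equivFunOnFinite.symm c)
    (∏ w, headPow (rowForm t 1 w) (MvPolynomial.C t * MvPolynomial.X w) (c w)) with hK
  have h1 : ∀ c : Fin N → Fin (M + 1), (∏ v : Fin N, (z * q ^ (v : ℕ)) ^ (c v : ℕ))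
      = z ^ (∑ v, (c v : ℕ)) * ∏ v : Fin N, (q ^ (v : ℕ)) ^ (c v : ℕ) := by
    intro c
    simp only [mul_pow, Finset.prod_mul_distrib, Finset.prod_pow_eq_pow_sum]
  have h2 : ∑ n ∈ Finset.range (M + 1), z ^ n *
        ∑ c ∈ Finset.piAntidiag (Finset.univ : Finset (Fin N)) n,
          (∏ v : Fin N, (q ^ (v : ℕ)) ^ c v) * K c
      = ∑ n ∈ Finset.range (M + 1), ∑ c ∈ Finset.univ.filter
          (fun c : Fin N → Fin (M + 1) => ∑ v, (c v : ℕ) = n),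
          (∏ v : Fin N, (z * q ^ (v : ℕ)) ^ (c v : ℕ)) * K (fun v => c v) := by
    refine Finset.sum_congr rfl fun n hn => ?_
    rw [Finset.mul_sum]
    refine (Finset.sum_bij (fun c _ v => (c v : ℕ)) ?_ ?_ ?_ ?_).symm
    · intro c hc
      simpa [Finset.mem_piAntidiag] using hc
    · intro c _ c' _ h
      funext v
      exact Fin.ext (congrFun h v)
    · intro c hc
      have hc' : ∑ v, c v = n := by simpa using (Finset.mem_piAntidiag.1 hc).1
      have hlt : ∀ v, c v < M + 1 := fun v => by
        have h3 := Finset.single_le_sum (f := c) (fun _ _ => Nat.zero_le _) (Finset.mem_univ v)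
        have h4 := Finset.mem_range.1 hn
        omega
      exact ⟨fun v => ⟨c v, hlt v⟩, by simpa using hc', rfl⟩
    · intro c hc
      rw [h1, (Finset.mem_filter.1 hc).2, mul_assoc]
  rw [h2, ← Finset.sum_filter_add_sum_filter_not Finset.univ
    (fun c : Fin N → Fin (M + 1) => ∑ v, (c v : ℕ) ∈ Finset.range (M + 1))]
  rw [Finset.sum_eq_zero (s := Finset.filter (fun c : Fin N → Fin (M + 1) =>
    ¬ ∑ v, (c v : ℕ) ∈ Finset.range (M + 1)) Finset.univ), add_zero]
  · rw [← Finset.sum_fiberwise_of_maps_to (g := fun c : Fin N → Fin (M + 1) => ∑ v, (c v : ℕ))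
      (t := Finset.range (M + 1)) (fun c hc => (Finset.mem_filter.1 hc).2)]
    refine Finset.sum_congr rfl fun n hn => ?_
    refine Finset.sum_congr ?_ fun _ _ => rfl
    ext c
    simp only [Finset.mem_filter, Finset.mem_univ, true_and]
    exact ⟨fun h => h.2, fun h => ⟨h ▸ hn, h⟩⟩
  · intro c hc
    have h5 : M + 1 ≤ ∑ v, (c v : ℕ) := by simpa using hc
    rw [h1, pow_eq_zero_of_le h5 hz, zero_mul, zero_mul]

theorem coeff_sum_C_mul_X_pow {Λ : Type*} [CommRing Λ] (a : ℕ → Λ) (M k : ℕ) (hk : k ≤ M) :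
    (∑ n ∈ Finset.range (M + 1), C (a n) * X ^ n : Λ[X]).coeff k = a k := by
  rw [finsetSum_coeff]
  simp only [coeff_C_mul_X_pow]
  rw [Finset.sum_eq_single k]
  · simp
  · intro b _ hb
    rw [if_neg hb.symm]
  · intro h
    exact absurd (Finset.mem_range.2 (Nat.lt_succ_of_le hk)) h

/-- The coefficient of `z^(n+1)` in `masterSum_functional` at `x v = z q^v`. The tail of this
sequence is `(z q) q^v` with one letter fewer, hence the factors `q ^ p.2`. -/
theorem boundedGF_succ {Λ : Type*} [CommRing Λ] (t q : Λ) (N n : ℕ) :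
    boundedGF t q (N + 1) (n + 1) = boundedGF t q (N + 1) n
      + t * ∑ p ∈ Finset.HasAntidiagonal.antidiagonal n,
          boundedGF t q (N + 1) p.1 * (q ^ p.2 * boundedGF t q N p.2)
      + q ^ (n + 1) * boundedGF t q N (n + 1) - t * q ^ n * boundedGF t q N n := by
  set M := n + 1 with hM
  set G' : Λ[X] := ∑ k ∈ Finset.range (M + 1), C (boundedGF t q (N + 1) k) * X ^ k with hG'
  set G : Λ[X] := ∑ k ∈ Finset.range (M + 1), C (q ^ k * boundedGF t q N k) * X ^ k with hG
  -- The nilpotent `z` is the class of `X` modulo `X ^ (M + 1)`; coefficients up to `M = n + 1`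
  -- survive.
  set π := Ideal.Quotient.mk (Ideal.span {(X : Λ[X]) ^ (M + 1)}) with hπ
  set f : Λ →+* Λ[X] ⧸ Ideal.span {(X : Λ[X]) ^ (M + 1)} := π.comp C with hf
  have hz : (π X) ^ (M + 1) = 0 := by
    rw [← map_pow, hπ, Ideal.Quotient.eq_zero_iff_mem]
    exact Ideal.mem_span_singleton_self _
  have e1 : masterSum M (f t) 1 (fun v : Fin (N + 1) => π X * f q ^ (v : ℕ)) = π G' := by
    rw [masterSum_geometric _ _ _ hz, hG', map_sum]
    refine Finset.sum_congr rfl fun k _ => ?_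
    rw [← map_boundedGF, map_mul, map_pow, mul_comm, hf, RingHom.comp_apply]
  have e2 : masterSum M (f t) 1 (Fin.tail fun v : Fin (N + 1) => π X * f q ^ (v : ℕ)) = π G := by
    have : (Fin.tail fun v : Fin (N + 1) => π X * f q ^ (v : ℕ))
        = fun v : Fin N => (π X * f q) * f q ^ (v : ℕ) := by
      funext v
      simp only [Fin.tail, Fin.val_succ, pow_succ]
      ring
    rw [this, masterSum_geometric _ _ _ (by rw [mul_pow, hz, zero_mul]), hG, map_sum]
    refine Finset.sum_congr rfl fun k _ => ?_
    rw [← map_boundedGF, map_mul, map_pow, map_mul, map_mul, map_pow, map_pow, hf,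
      RingHom.comp_apply, RingHom.comp_apply]
    ring
  have h := masterSum_functional (M := M) (f t)
    (fun v : Fin (N + 1) => π X * f q ^ (v : ℕ)) (fun v => by rw [mul_pow, hz, zero_mul])
  rw [e1, e2] at h
  simp only [Fin.val_zero, pow_zero, mul_one] at h
  have h0 : π (G' * (1 - X - C t * X * G) - (1 - C t * X) * G) = 0 := by
    rw [map_sub, sub_eq_zero]
    simpa [hf] using h
  rw [hπ, Ideal.Quotient.eq_zero_iff_mem, Ideal.mem_span_singleton, X_pow_dvd_iff] at h0
  have h1 := h0 (n + 1) (by omega)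
  have e3 : G' * (1 - X - C t * X * G) - (1 - C t * X) * G
      = G' - G' * X - C t * (G' * G * X) - G + C t * (G * X) := by ring
  have c1 : ∀ k, k ≤ M → G'.coeff k = boundedGF t q (N + 1) k := fun k hk =>
    coeff_sum_C_mul_X_pow _ _ _ hk
  have c2 : ∀ k, k ≤ M → G.coeff k = q ^ k * boundedGF t q N k := fun k hk =>
    coeff_sum_C_mul_X_pow (fun k => q ^ k * boundedGF t q N k) _ _ hk
  rw [e3] at h1
  simp only [coeff_add, coeff_sub, coeff_C_mul, coeff_mul_X] at h1
  rw [c1 _ (by omega), c1 _ (by omega), c2 _ (by omega), c2 _ (by omega), coeff_mul,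
    Finset.sum_congr rfl (g := fun p : ℕ × ℕ =>
      boundedGF t q (N + 1) p.1 * (q ^ p.2 * boundedGF t q N p.2))] at h1
  · linear_combination h1
  · intro p hp
    have := Finset.HasAntidiagonal.mem_antidiagonal.1 hp
    rw [c1 _ (by omega), c2 _ (by omega)]

theorem eq_zero_of_forall_pow_dvd {p : ℚ[X][X]} (h : ∀ N : ℕ, (C X : ℚ[X][X]) ^ N ∣ p) :
    p = 0 := by
  ext i j
  have h1 := h (j + 1)
  rw [← map_pow, C_dvd_iff_dvd_coeff] at h1
  have h2 := X_pow_dvd_iff.1 (h1 i) j (by omega)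
  simpa using h2

theorem C_qPoch (n : ℕ) :
    (C (qPoch n) : ℚ[X][X]) = ∏ i : Fin n, (1 - (C X : ℚ[X][X]) ^ ((i : ℕ) + 1)) := by
  rw [Fin.prod_univ_eq_prod_range (fun i => 1 - (C X : ℚ[X][X]) ^ (i + 1))]
  induction n with
  | zero => simp [qPoch]
  | succ n ih => rw [qPoch_succ, map_mul, ih, Finset.prod_range_succ]; simp

/-- Modulo `q^N`, multiplication by `(q;q)_k` turns `boundedGF` with at least `N` letters into
`qEulerian k`. So `boundedGF_succ` multiplied by `(q;q)_{n+1}` is the claim times `1 - q^(n+1)`,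
modulo every `q^N`. -/
theorem qEulerian_succ (n : ℕ) :
    qEulerian (n + 1) = qEulerian n
      + X * ∑ p ∈ Finset.HasAntidiagonal.antidiagonal n,
          C (qBinom n p.2) * (qEulerian p.1 * ((C X) ^ p.2 * qEulerian p.2))
      - X * (C X) ^ n * qEulerian n := by
  have hne : (1 - (C X : ℚ[X][X]) ^ (n + 1)) ≠ 0 := by
    intro h
    have h1 := qPoch_ne_zero (n + 1)
    rw [qPoch_succ] at h1
    apply right_ne_zero_of_mul h1
    apply C_injective
    simpa using h
  refine mul_left_cancel₀ hne (sub_eq_zero.1 (eq_zero_of_forall_pow_dvd fun N => ?_))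
  obtain ⟨Q, _, π, hπ⟩ : ∃ (Q : Type) (_ : CommRing Q) (π : ℚ[X][X] →+* Q),
      ∀ a b, π a = π b ↔ (C X : ℚ[X][X]) ^ N ∣ a - b :=
    ⟨ℚ[X][X] ⧸ Ideal.span {(C X : ℚ[X][X]) ^ N}, Ideal.Quotient.commRing _, Ideal.Quotient.mk (Ideal.span {(C X : ℚ[X][X]) ^ N}), fun a b => by
      rw [Ideal.Quotient.eq, Ideal.mem_span_singleton]⟩
  rw [← hπ]
  have hA : ∀ K k, N ≤ K → π (C (qPoch k)) * π (boundedGF (X : ℚ[X][X]) (C X) K k) = π (qEulerian k) := by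
    intro K k hK
    rw [← map_mul, hπ, C_qPoch]
    exact (pow_dvd_pow _ hK).trans (dvd_prod_mul_boundedGF (X : ℚ[X][X]) (C X) K k)
  have hb := congrArg (fun y => π (C (qPoch (n + 1)) * y))
    (boundedGF_succ (X : ℚ[X][X]) (C X) N n)
  have hsucc : π (C (qPoch (n + 1))) = π (C (qPoch n)) * π (1 - (C X) ^ (n + 1)) := by
    rw [← map_mul, qPoch_succ]
    simp
  have hs : π (C (qPoch n)) * π (∑ p ∈ Finset.HasAntidiagonal.antidiagonal n,
          boundedGF (X : ℚ[X][X]) (C X) (N + 1) p.1 * ((C X) ^ p.2 * boundedGF (X : ℚ[X][X]) (C X) N p.2))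
      = π (∑ p ∈ Finset.HasAntidiagonal.antidiagonal n,
          C (qBinom n p.2) * (qEulerian p.1 * ((C X) ^ p.2 * qEulerian p.2))) := by
    rw [map_sum, map_sum, Finset.mul_sum]
    refine Finset.sum_congr rfl fun p hp => ?_
    have hp' := Finset.HasAntidiagonal.mem_antidiagonal.1 hp
    have h2 := qBinom_mul (n := n) (m := p.2) (by omega)
    rw [show n - p.2 = p.1 by omega] at h2
    rw [← h2]
    simp only [map_mul]
    rw [← hA (N + 1) p.1 (by omega), ← hA N p.2 le_rfl]
    ring
  simp only [map_mul, map_add, map_sub, mul_add, mul_sub] at hb ⊢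
  have a1 := hA (N + 1) (n + 1) (by omega)
  have a2 := hA N (n + 1) le_rfl
  have a3 := hA (N + 1) n (by omega)
  have a4 := hA N n le_rfl
  have e1 : π 1 = 1 := map_one _
  simp only [map_sub, map_pow, e1] at hsucc hb ⊢
  linear_combination hb - a1 + (π (C X)) ^ (n + 1) * a2
    + (1 - π (C X) ^ (n + 1)) * a3 - π X * π (C X) ^ n * (1 - π (C X) ^ (n + 1)) * a4
    + π X * (1 - π (C X) ^ (n + 1)) * hs
    + (π (boundedGF (X : ℚ[X][X]) (C X) (N + 1) n) - π X * π (C X) ^ n * π (boundedGF (X : ℚ[X][X]) (C X) N n)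
      + π X * π (∑ p ∈ Finset.HasAntidiagonal.antidiagonal n,
          boundedGF (X : ℚ[X][X]) (C X) (N + 1) p.1 * ((C X) ^ p.2 * boundedGF (X : ℚ[X][X]) (C X) N p.2))) * hsucc

end Recurrence

/-! ### From the `q`-Eulerian to the `q`-binomial-Eulerian recurrence by generating functions. -/

section BinomialRecurrence

theorem qEulerian_zero : qEulerian 0 = 1 := by
  simp [qEulerian, exc, maj]

theorem qBinomialEulerian_zero : qBinomialEulerian 0 = 1 := by
  simp [qBinomialEulerian]

theorem qBinom_zero_right (n : ℕ) : qBinom n 0 = 1 := by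
  have h := qBinom_mul (Nat.zero_le n)
  have h0 : qPoch 0 = 1 := by simp [qPoch]
  rw [h0, one_mul, Nat.sub_zero] at h
  exact mul_right_cancel₀ (qPoch_ne_zero n) (by rw [h, one_mul])

theorem qBinom_self (n : ℕ) : qBinom n n = 1 := by
  have h := qBinom_mul (le_refl n)
  have h0 : qPoch 0 = 1 := by simp [qPoch]
  rw [Nat.sub_self, h0, mul_one] at h
  exact mul_right_cancel₀ (qPoch_ne_zero n) (by rw [h, one_mul])

theorem qBinom_symm {n i j : ℕ} (h : i + j = n) : qBinom n i = qBinom n j := by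
  have h1 := qBinom_mul (n := n) (m := i) (by omega)
  have h2 := qBinom_mul (n := n) (m := j) (by omega)
  rw [show n - i = j by omega] at h1
  rw [show n - j = i by omega, mul_comm (qPoch j)] at h2
  exact mul_right_cancel₀ (mul_ne_zero (qPoch_ne_zero i) (qPoch_ne_zero j)) (h1.trans h2.symm)

variable {K : Type*} [Field K] (φ : ℚ[X][X] →+* K)

/-- The `q`-exponential generating function of a sequence of polynomials. -/
noncomputable def qExpGF (f : ℕ → ℚ[X][X]) : PowerSeries K :=
  PowerSeries.mk fun n => φ (f n) / φ (C (qPoch n))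

theorem map_qPoch_ne_zero (hφ : Function.Injective φ) (n : ℕ) : φ (C (qPoch n)) ≠ 0 := by
  rw [map_ne_zero_iff _ hφ, map_ne_zero_iff _ C_injective]
  exact qPoch_ne_zero n

theorem map_qPoch_succ (n : ℕ) :
    φ (C (qPoch (n + 1))) = φ (C (qPoch n)) * (1 - φ (C X) ^ (n + 1)) := by
  rw [qPoch_succ]
  simp

/-- The factor `1 - q^(n+1)` cancels the last factor of `(q;q)_{n+1}`, so `F(z) - F(qz)` shifts the
sequence by one. -/
theorem coeff_qExpGF_sub_rescale (hφ : Function.Injective φ) (f : ℕ → ℚ[X][X]) (n : ℕ) :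
    PowerSeries.coeff (n + 1) (qExpGF φ f - PowerSeries.rescale (φ (C X)) (qExpGF φ f))
      = φ (f (n + 1)) / φ (C (qPoch n)) := by
  have h1 := map_qPoch_succ φ n
  have h2 := map_qPoch_ne_zero φ hφ (n + 1)
  have h3 := map_qPoch_ne_zero φ hφ n
  rw [h1] at h2
  have h4 := right_ne_zero_of_mul h2
  rw [map_sub, PowerSeries.coeff_rescale, qExpGF, PowerSeries.coeff_mk, h1]
  field_simp

theorem map_qBinom (hφ : Function.Injective φ) {n i j : ℕ} (h : i + j = n) :
    φ (C (qBinom n j)) = φ (C (qPoch n)) / (φ (C (qPoch i)) * φ (C (qPoch j))) := by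
  have h1 := qBinom_mul (n := n) (m := j) (by omega)
  rw [show n - j = i by omega] at h1
  have h2 := map_qPoch_ne_zero φ hφ i
  have h3 := map_qPoch_ne_zero φ hφ j
  rw [← h1]
  simp only [map_mul]
  field_simp

theorem coeff_qExpGF_mul_rescale (hφ : Function.Injective φ) (f g : ℕ → ℚ[X][X]) (n : ℕ) :
    PowerSeries.coeff n (qExpGF φ f * PowerSeries.rescale (φ (C X)) (qExpGF φ g))
      = φ (∑ p ∈ Finset.HasAntidiagonal.antidiagonal n,
          C (qBinom n p.2) * (f p.1 * ((C X) ^ p.2 * g p.2))) / φ (C (qPoch n)) := by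
  rw [PowerSeries.coeff_mul, map_sum, Finset.sum_div]
  refine Finset.sum_congr rfl fun p hp => ?_
  have hp' := Finset.HasAntidiagonal.mem_antidiagonal.1 hp
  have h1 := map_qPoch_ne_zero φ hφ n
  have h2 := map_qPoch_ne_zero φ hφ p.1
  have h3 := map_qPoch_ne_zero φ hφ p.2
  rw [PowerSeries.coeff_rescale, qExpGF, qExpGF, PowerSeries.coeff_mk, PowerSeries.coeff_mk,
    map_mul, map_qBinom φ hφ hp', map_mul, map_mul, map_pow]
  field_simp

theorem coeff_zero_sub_rescale (f : PowerSeries K) (q : K) :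
    PowerSeries.coeff 0 (f - PowerSeries.rescale q f) = 0 := by
  rw [map_sub, PowerSeries.coeff_rescale, pow_zero, one_mul, sub_self]

theorem rescale_C (a q : K) : PowerSeries.rescale q (PowerSeries.C a) = PowerSeries.C a := by
  ext n
  rw [PowerSeries.coeff_rescale, PowerSeries.coeff_C]
  split_ifs with h <;> simp [h]

theorem qExpGF_qEulerian (hφ : Function.Injective φ) :
    qExpGF φ qEulerian - PowerSeries.rescale (φ (C X)) (qExpGF φ qEulerian)
      = PowerSeries.X * (qExpGF φ qEulerian + PowerSeries.C (φ X) *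
          (qExpGF φ qEulerian * PowerSeries.rescale (φ (C X)) (qExpGF φ qEulerian))
        - PowerSeries.C (φ X) * PowerSeries.rescale (φ (C X)) (qExpGF φ qEulerian)) := by
  ext n
  cases n with
  | zero => rw [coeff_zero_sub_rescale, PowerSeries.coeff_zero_X_mul]
  | succ n =>
    rw [coeff_qExpGF_sub_rescale φ hφ, PowerSeries.coeff_succ_X_mul, map_sub, map_add,
      PowerSeries.coeff_C_mul, PowerSeries.coeff_C_mul, coeff_qExpGF_mul_rescale φ hφ,
      PowerSeries.coeff_rescale, qEulerian_succ, qExpGF, PowerSeries.coeff_mk]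
    simp only [map_sub, map_add, map_mul φ X, map_mul φ (X * _), map_pow]
    ring

theorem qExpGF_one (hφ : Function.Injective φ) :
    qExpGF φ (fun _ => 1) - PowerSeries.rescale (φ (C X)) (qExpGF φ fun _ => 1)
      = PowerSeries.X * qExpGF φ fun _ => 1 := by
  ext n
  cases n with
  | zero => rw [coeff_zero_sub_rescale, PowerSeries.coeff_zero_X_mul]
  | succ n =>
    rw [coeff_qExpGF_sub_rescale φ hφ, PowerSeries.coeff_succ_X_mul, qExpGF,
      PowerSeries.coeff_mk]

theorem qExpGF_qBinomialEulerian (hφ : Function.Injective φ) :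
    qExpGF φ qBinomialEulerian = qExpGF φ (fun _ => 1) *
      (1 - PowerSeries.C (φ X) + PowerSeries.C (φ X) * qExpGF φ qEulerian) := by
  ext n
  have h1 := map_qPoch_ne_zero φ hφ n
  have h2 : qBinomialEulerian n = 1 - X
      + X * ∑ p ∈ Finset.HasAntidiagonal.antidiagonal n, C (qBinom n p.2) * qEulerian p.2 := by
    rw [← Finset.Nat.sum_antidiagonal_swap, Finset.Nat.sum_antidiagonal_eq_sum_range_succ_mk,
      Finset.range_eq_Ico, Finset.sum_eq_sum_Ico_succ_bot (Nat.succ_pos n), qBinomialEulerian,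
      show Finset.Icc 1 n = Finset.Ico (0 + 1) n.succ by ext; simp]
    simp only [Prod.swap, qBinom_zero_right, qEulerian_zero, map_one]
    ring
  have h3 : qExpGF φ (fun _ => 1) *
      (1 - PowerSeries.C (φ X) + PowerSeries.C (φ X) * qExpGF φ qEulerian)
      = qExpGF φ (fun _ => 1) - PowerSeries.C (φ X) * qExpGF φ (fun _ => 1)
        + PowerSeries.C (φ X) * (qExpGF φ (fun _ => 1) * qExpGF φ qEulerian) := by ring
  rw [h3, map_add, map_sub, PowerSeries.coeff_C_mul, PowerSeries.coeff_C_mul,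
    PowerSeries.coeff_mul, qExpGF, qExpGF, qExpGF, PowerSeries.coeff_mk, PowerSeries.coeff_mk, h2]
  simp only [PowerSeries.coeff_mk, map_add, map_sub, map_one, map_mul, map_sum]
  rw [add_div, sub_div, mul_div_assoc, Finset.sum_div, mul_one_div]
  congr 2
  refine Finset.sum_congr rfl fun p hp => ?_
  have hp' := Finset.HasAntidiagonal.mem_antidiagonal.1 hp
  have h4 := map_qPoch_ne_zero φ hφ p.1
  have h5 := map_qPoch_ne_zero φ hφ p.2
  rw [map_qBinom φ hφ hp']
  field_simp

/-- The generating function of `B` is `e H` with `H = 1 - t + t A`. Expanding `e H - e(qz) H(qz)` by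
the product rule, with the difference equations of `e` and `A`, gives `z e H (1 + t A(qz))`. -/
theorem qBinomialEulerian_succ (n : ℕ) :
    qBinomialEulerian (n + 1) = qBinomialEulerian n
      + X * ∑ p ∈ Finset.HasAntidiagonal.antidiagonal n,
          C (qBinom n p.2) * (qBinomialEulerian p.1 * ((C X) ^ p.2 * qEulerian p.2)) := by
  set φ := algebraMap ℚ[X][X] (FractionRing ℚ[X][X])
  have hφ : Function.Injective φ := IsFractionRing.injective _ _
  have hA := qExpGF_qEulerian φ hφ
  have he := qExpGF_one φ hφ
  have hB := qExpGF_qBinomialEulerian φ hφ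
  have hB' := congrArg (PowerSeries.rescale (φ (C X))) hB
  simp only [map_mul, map_add, map_sub, map_one, rescale_C] at hB'
  have key : qExpGF φ qBinomialEulerian
        - PowerSeries.rescale (φ (C X)) (qExpGF φ qBinomialEulerian)
      = PowerSeries.X * (qExpGF φ qBinomialEulerian + PowerSeries.C (φ X) *
        (qExpGF φ qBinomialEulerian * PowerSeries.rescale (φ (C X)) (qExpGF φ qEulerian))) := by
    rw [hB', hB]
    linear_combination (1 - PowerSeries.C (φ X) + PowerSeries.C (φ X) *
        PowerSeries.rescale (φ (C X)) (qExpGF φ qEulerian)) * he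
      + PowerSeries.C (φ X) * qExpGF φ (fun _ => 1) * hA
  have h := congrArg (PowerSeries.coeff (n + 1)) key
  rw [coeff_qExpGF_sub_rescale φ hφ, PowerSeries.coeff_succ_X_mul, map_add,
    PowerSeries.coeff_C_mul, coeff_qExpGF_mul_rescale φ hφ, qExpGF, PowerSeries.coeff_mk] at h
  have hp := map_qPoch_ne_zero φ hφ n
  rw [← mul_div_assoc, ← add_div, div_left_inj' hp] at h
  apply hφ
  rw [h]
  simp only [map_add, map_mul φ X]

end BinomialRecurrence

/-! ### Subsets counted by inversions, and words cut at a letter. -/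

section Arrangements

theorem qBinom_succ_succ {n k : ℕ} (h : k + 1 ≤ n) :
    qBinom (n + 1) (k + 1) = qBinom n (k + 1) + X ^ (n - k) * qBinom n k := by
  obtain ⟨d, rfl⟩ := Nat.exists_eq_add_of_le h
  have h1 := qBinom_mul (n := k + 1 + d + 1) (m := k + 1) (by omega)
  have h2 := qBinom_mul (n := k + 1 + d) (m := k + 1) (by omega)
  have h3 := qBinom_mul (n := k + 1 + d) (m := k) (by omega)
  rw [show k + 1 + d + 1 - (k + 1) = d + 1 by omega] at h1
  rw [show k + 1 + d - (k + 1) = d by omega] at h2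
  rw [show k + 1 + d - k = d + 1 by omega] at h3 ⊢
  refine mul_right_cancel₀ (mul_ne_zero (qPoch_ne_zero (k + 1)) (qPoch_ne_zero (d + 1))) ?_
  rw [h1, qPoch_succ (k + 1 + d)]
  have e1 := qPoch_succ d
  have e2 := qPoch_succ k
  have e3 : (X : ℚ[X]) ^ (k + 1 + d + 1) = X ^ (d + 1) * X ^ (k + 1) := by ring
  rw [e3]
  linear_combination (-(1 - (X : ℚ[X]) ^ (d + 1))) * h2
    - (X ^ (d + 1) * (1 - (X : ℚ[X]) ^ (k + 1))) * h3
    - qBinom (k + 1 + d) (k + 1) * qPoch (k + 1) * e1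
    - X ^ (d + 1) * qBinom (k + 1 + d) k * qPoch (d + 1) * e2

/-- The number of pairs `(a, b)` with `a ∈ T`, `b ∈ R` and `b < a`. -/
def invSet (T R : Finset ℕ) : ℕ :=
  ∑ a ∈ T, (R.filter fun b => b < a).card

/-- By induction on the largest element `m`. Outside `T` it forms no counted pair; inside `T` it
exceeds everything left outside. This is the `q`-Pascal rule. -/
theorem sum_powersetCard_invSet (S : Finset ℕ) :
    ∀ k ≤ S.card, ∑ T ∈ S.powersetCard k, (X : ℚ[X]) ^ invSet T (S \ T) = qBinom S.card k := by
  induction S using Finset.induction_on_max with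
  | empty =>
    intro k hk
    obtain rfl : k = 0 := by simpa using hk
    simp [invSet, qBinom_self]
  | insert m S hm ih =>
    have hmS : m ∉ S := fun h => lt_irrefl _ (hm m h)
    intro k hk
    rw [Finset.card_insert_of_notMem hmS] at hk ⊢
    rcases k with _ | k
    · simp [invSet, qBinom_zero_right]
    rw [Finset.powersetCard_succ_insert hmS, Finset.sum_union, Finset.sum_image]
    · have e1 : ∀ T ∈ S.powersetCard (k + 1),
          (X : ℚ[X]) ^ invSet T (insert m S \ T) = X ^ invSet T (S \ T) := by
        intro T hT
        have hTS := (Finset.mem_powersetCard.1 hT).1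
        congr 1
        refine Finset.sum_congr rfl fun a ha => ?_
        congr 1
        ext b
        simp only [Finset.mem_filter, Finset.mem_sdiff, Finset.mem_insert]
        have := hm a (hTS ha)
        constructor
        · rintro ⟨⟨rfl | hb, hb'⟩, hlt⟩
          · omega
          · exact ⟨⟨hb, hb'⟩, hlt⟩
        · rintro ⟨⟨hb, hb'⟩, hlt⟩
          exact ⟨⟨Or.inr hb, hb'⟩, hlt⟩
      have e2 : ∀ T ∈ S.powersetCard k,
          (X : ℚ[X]) ^ invSet (insert m T) (insert m S \ insert m T)
            = X ^ (S.card - k) * X ^ invSet T (S \ T) := by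
        intro T hT
        obtain ⟨hTS, hTk⟩ := Finset.mem_powersetCard.1 hT
        have hmT : m ∉ T := fun h => hmS (hTS h)
        have e3 : insert m S \ insert m T = S \ T := by
          ext b
          simp only [Finset.mem_sdiff, Finset.mem_insert]
          constructor
          · rintro ⟨rfl | hb, hb'⟩
            · exact absurd (Or.inl rfl) hb'
            · exact ⟨hb, fun h => hb' (Or.inr h)⟩
          · rintro ⟨hb, hb'⟩
            refine ⟨Or.inr hb, ?_⟩
            rintro (rfl | h)
            · exact hmS hb
            · exact hb' h
        rw [e3, invSet, Finset.sum_insert hmT, pow_add]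
        congr 2
        rw [Finset.filter_true_of_mem fun b hb => hm b (Finset.mem_sdiff.1 hb).1,
          Finset.card_sdiff_of_subset hTS, hTk]
      rw [Finset.sum_congr rfl e1, Finset.sum_congr rfl e2, ← Finset.mul_sum,
        ih k (by omega)]
      by_cases hk' : k + 1 ≤ S.card
      · rw [ih (k + 1) hk', qBinom_succ_succ hk']
      · obtain rfl : k = S.card := by omega
        rw [Finset.powersetCard_eq_empty.2 (by omega)]
        simp [qBinom_self]
    · intro T hT T' hT' h
      have h1 : m ∉ T := fun h => hmS ((Finset.mem_powersetCard.1 hT).1 h)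
      have h2 : m ∉ T' := fun h => hmS ((Finset.mem_powersetCard.1 hT').1 h)
      rw [← Finset.erase_insert h1, ← Finset.erase_insert h2, h]
    · rw [Finset.disjoint_left]
      intro T hT hT'
      obtain ⟨T', _, rfl⟩ := Finset.mem_image.1 hT'
      exact hmS ((Finset.mem_powersetCard.1 hT).1 (Finset.mem_insert_self _ _))

theorem sum_powerset_invSet (S : Finset ℕ) (h : ℕ × ℕ → ℚ[X][X]) :
    ∑ T ∈ S.powerset, (C X : ℚ[X][X]) ^ invSet T (S \ T) * h (T.card, (S \ T).card)
      = ∑ p ∈ Finset.HasAntidiagonal.antidiagonal S.card, C (qBinom S.card p.2) * h p := by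
  rw [Finset.sum_powerset, Finset.Nat.sum_antidiagonal_eq_sum_range_succ_mk]
  refine Finset.sum_congr rfl fun k hk => ?_
  have hk' : k ≤ S.card := by have := Finset.mem_range.1 hk; omega
  rw [qBinom_symm (i := S.card - k) (j := k) (by omega), ← sum_powersetCard_invSet S k hk',
    map_sum, Finset.sum_mul]
  refine Finset.sum_congr rfl fun T hT => ?_
  obtain ⟨hTS, hTk⟩ := Finset.mem_powersetCard.1 hT
  rw [Finset.card_sdiff_of_subset hTS, hTk, map_pow]

/-- The arrangements of a finite set as lists. -/
def arrangements (S : Finset ℕ) : Finset (List ℕ) :=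
  S.val.lists.toFinset

theorem mem_arrangements {S : Finset ℕ} {l : List ℕ} :
    l ∈ arrangements S ↔ l.Nodup ∧ ∀ x, x ∈ l ↔ x ∈ S := by
  unfold arrangements
  rw [Multiset.mem_toFinset, Multiset.mem_lists_iff]
  constructor
  · intro h
    refine ⟨?_, fun x => ?_⟩
    · have := S.nodup
      rw [h] at this
      exact Multiset.coe_nodup.1 this
    · rw [← Finset.mem_val, h]
      exact Multiset.mem_coe.symm
  · rintro ⟨h1, h2⟩
    exact (Multiset.Nodup.ext S.nodup (Multiset.coe_nodup.2 h1)).2 fun x => (h2 x).symm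

theorem length_of_mem_arrangements {S : Finset ℕ} {l : List ℕ} (h : l ∈ arrangements S) :
    l.length = S.card := by
  obtain ⟨h1, h2⟩ := mem_arrangements.1 h
  rw [← List.toFinset_card_of_nodup h1]
  congr 1
  ext x
  simp [h2]

theorem arrangements_empty : arrangements ∅ = {[]} := by
  ext l
  rw [mem_arrangements, Finset.mem_singleton, List.eq_nil_iff_forall_not_mem]
  constructor
  · rintro ⟨_, h⟩ x hx
    simpa using (h x).1 hx
  · intro h
    obtain rfl := List.eq_nil_iff_forall_not_mem.2 h
    simp

theorem sum_arrangements_insert {A : Type*} [AddCommMonoid A] {S : Finset ℕ} {m : ℕ}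
    (hm : m ∉ S) (f : List ℕ → A) :
    ∑ l ∈ arrangements (insert m S), f l
      = ∑ T ∈ S.powerset, ∑ L ∈ arrangements T, ∑ R ∈ arrangements (S \ T), f (L ++ m :: R) := by
  simp only [← Finset.sum_product']
  rw [Finset.sum_sigma']
  refine (Finset.sum_bij (fun p _ => p.2.1 ++ m :: p.2.2) ?_ ?_ ?_ fun _ _ => rfl).symm
  · rintro ⟨T, L, R⟩ h
    simp only [Finset.mem_sigma, Finset.mem_powerset, Finset.mem_product, mem_arrangements,
      Finset.mem_sdiff] at h ⊢
    obtain ⟨hT, ⟨hL, hL'⟩, hR, hR'⟩ := h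
    constructor
    · rw [List.nodup_append, List.nodup_cons]
      refine ⟨hL, ⟨fun h => hm ((hR' m).1 h).1, hR⟩, ?_⟩
      rintro a ha b hb rfl
      rcases List.mem_cons.1 hb with rfl | hb
      · exact hm (hT ((hL' _).1 ha))
      · exact ((hR' _).1 hb).2 ((hL' _).1 ha)
    · intro x
      simp only [List.mem_append, List.mem_cons, hL', hR', Finset.mem_insert]
      constructor
      · rintro (h | h | h)
        · exact Or.inr (hT h)
        · exact Or.inl h
        · exact Or.inr h.1
      · rintro (h | h)
        · exact Or.inr (Or.inl h)
        · by_cases hx : x ∈ T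
          · exact Or.inl hx
          · exact Or.inr (Or.inr ⟨h, hx⟩)
  · rintro ⟨T, L, R⟩ h ⟨T', L', R'⟩ h' he
    simp only [Finset.mem_sigma, Finset.mem_powerset, Finset.mem_product, mem_arrangements,
      Finset.mem_sdiff] at h h' he
    have hmL : m ∉ L := fun hx => hm (h.1 ((h.2.1.2 m).1 hx))
    have hmL' : m ∉ L' := fun hx => hm (h'.1 ((h'.2.1.2 m).1 hx))
    obtain ⟨rfl, rfl⟩ : L = L' ∧ R = R' := by
      rcases List.append_eq_append_iff.1 he with ⟨a, ha, hb⟩ | ⟨a, ha, hb⟩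
      · cases a with
        | nil => simp_all
        | cons c a =>
          rw [List.cons_append, List.cons.injEq] at hb
          exact absurd (by rw [ha, hb.1]; simp) hmL'
      · cases a with
        | nil => simp_all
        | cons c a =>
          rw [List.cons_append, List.cons.injEq] at hb
          exact absurd (by rw [ha, hb.1]; simp) hmL
    obtain rfl : T = T' := by
      ext x
      rw [← h.2.1.2, ← h'.2.1.2]
    rfl
  · intro l hl
    obtain ⟨h1, h2⟩ := mem_arrangements.1 hl
    obtain ⟨L, R, rfl⟩ := List.append_of_mem ((h2 m).2 (Finset.mem_insert_self _ _))
    rw [List.nodup_append, List.nodup_cons] at h1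
    obtain ⟨hL, ⟨hmR, hR⟩, hd⟩ := h1
    have hsub : ∀ x, x ∈ L ∨ x ∈ R → x ∈ S := by
      intro x hx
      have h3 := (h2 x).1 (by
        rcases hx with hx | hx
        · exact List.mem_append_left _ hx
        · exact List.mem_append_right _ (List.mem_cons_of_mem _ hx))
      rcases Finset.mem_insert.1 h3 with rfl | h4
      · rcases hx with hx | hx
        · exact absurd rfl (hd _ hx _ (List.mem_cons_self))
        · exact absurd hx hmR
      · exact h4
    refine ⟨⟨L.toFinset, L, R⟩, ?_, rfl⟩
    simp only [Finset.mem_sigma, Finset.mem_powerset, Finset.mem_product, mem_arrangements,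
      Finset.mem_sdiff, List.mem_toFinset]
    refine ⟨fun x hx => hsub x (Or.inl (List.mem_toFinset.1 hx)), ⟨hL, fun _ => trivial⟩, hR,
      fun x => ⟨fun hx => ⟨hsub x (Or.inr hx), fun hx' =>
        hd _ hx' _ (List.mem_cons_of_mem _ hx) rfl⟩, ?_⟩⟩
    rintro ⟨hx, hx'⟩
    have := (h2 x).2 (Finset.mem_insert_of_mem hx)
    rcases List.mem_append.1 this with h | h
    · exact absurd h hx'
    · rcases List.mem_cons.1 h with rfl | h
      · exact absurd hx hm
      · exact h

end Arrangements

/-! ### Descents and admissible inversions of lists, cut at the largest letter. -/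

section ListStatistics

/-- The number of descents of the list `l` preceded by the letter `p`. -/
def desFrom : ℕ → List ℕ → ℕ
  | _, [] => 0
  | p, a :: l => (if a < p then 1 else 0) + desFrom a l

/-- The number of letters of `l` smaller than `a`. -/
def countLess (a : ℕ) (l : List ℕ) : ℕ :=
  l.countP (· < a)

/-- The number of letters of `l` that are smaller than `a` and come after a letter larger than
`a`. -/
def countLessAfter (a : ℕ) : List ℕ → ℕ
  | [] => 0
  | b :: l => if a < b then countLess a l else countLessAfter a l

/-- The number of admissible inversions inside the list `l` preceded by the letter `p`. -/
def aiFrom : ℕ → List ℕ → ℕ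
  | _, [] => 0
  | p, a :: l => (if p < a then countLess a l else countLessAfter a l) + aiFrom a l

/-- The list `l`, preceded by the letter `p`, has no ascent before the letter `0`. -/
def PRWFrom : ℕ → List ℕ → Prop
  | _, [] => True
  | p, a :: l => p = 0 ∨ (a < p ∧ PRWFrom a l)

/-- The number of inversions between two lists. -/
def listInv : List ℕ → List ℕ → ℕ
  | [], _ => 0
  | a :: l, R => countLess a R + listInv l R

theorem desFrom_append_cons {m : ℕ} (R : List ℕ) :
    ∀ (L : List ℕ) (p : ℕ), p ≤ m → (∀ x ∈ L, x < m) →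
      desFrom p (L ++ m :: R) = desFrom p L + desFrom m R
  | [], p, hp, _ => by simp [desFrom, not_lt.2 hp]
  | a :: L, p, hp, hL => by
    rw [List.forall_mem_cons] at hL
    simp only [List.cons_append, desFrom]
    rw [desFrom_append_cons R L a hL.1.le hL.2, add_assoc]

theorem desFrom_of_lt {m : ℕ} {R : List ℕ} (hR : ∀ x ∈ R, x < m) :
    desFrom m R = (if R = [] then 0 else 1) + desFrom 0 R := by
  cases R with
  | nil => simp [desFrom]
  | cons a R => simp [desFrom, hR a List.mem_cons_self]

theorem countLess_append_cons {m a : ℕ} (ha : a < m) (L R : List ℕ) :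
    countLess a (L ++ m :: R) = countLess a L + countLess a R := by
  simp [countLess, ha.le]

theorem countLessAfter_append_cons {m a : ℕ} (ha : a < m) (L R : List ℕ) :
    countLessAfter a (L ++ m :: R) = countLessAfter a L + countLess a R := by
  induction L with
  | nil => simp [countLessAfter, ha]
  | cons b L ih =>
    simp only [List.cons_append, countLessAfter, ih, countLess_append_cons ha]
    split_ifs <;> rfl

theorem countLess_of_lt {m : ℕ} {R : List ℕ} (hR : ∀ x ∈ R, x < m) :
    countLess m R = R.length := by
  rw [countLess, List.countP_eq_length]
  simpa using hR

theorem countLessAfter_of_lt {m : ℕ} {R : List ℕ} (hR : ∀ x ∈ R, x < m) :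
    countLessAfter m R = 0 := by
  induction R with
  | nil => rfl
  | cons b R ih =>
    rw [List.forall_mem_cons] at hR
    rw [countLessAfter, if_neg hR.1.asymm, ih hR.2]

/-- The letter `m` stands between `L` and `R`, so all inversions from `L` to `R` are admissible.
Those from `m` into `R` are admissible unless `m` has no smaller predecessor, since no larger letter
follows it. -/
theorem aiFrom_append_cons {m : ℕ} {R : List ℕ} (hR : ∀ x ∈ R, x < m) :
    ∀ (L : List ℕ) (p : ℕ), (∀ x ∈ L, x < m) →
      aiFrom p (L ++ m :: R) = aiFrom p L + listInv L R
        + (if L = [] ∧ ¬ p < m then 0 else R.length) + aiFrom m R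
  | [], p, _ => by
    by_cases hp : p < m
    · simp [aiFrom, listInv, hp, countLess_of_lt hR]
    · simp [aiFrom, listInv, hp, countLessAfter_of_lt hR]
  | a :: L, p, hL => by
    rw [List.forall_mem_cons] at hL
    simp only [List.cons_append, aiFrom, listInv]
    rw [aiFrom_append_cons hR L a hL.2, countLess_append_cons hL.1,
      countLessAfter_append_cons hL.1]
    simp only [hL.1, not_true_eq_false, and_false, if_false, reduceCtorEq, false_and]
    split_ifs <;> ring

theorem PRWFrom_append_cons_of_mem {m : ℕ} {R : List ℕ} :
    ∀ {L : List ℕ} {p : ℕ}, p ≠ 0 → 0 ∈ L →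
      (PRWFrom p (L ++ m :: R) ↔ PRWFrom p L)
  | a :: L, p, hp, h0 => by
    simp only [List.cons_append, PRWFrom, hp, false_or]
    refine and_congr_right fun _ => ?_
    rcases eq_or_ne a 0 with rfl | ha
    · cases L <;> simp [PRWFrom]
    · have h0' : 0 ∈ L := by
        rcases List.mem_cons.1 h0 with h | h
        · exact absurd h.symm ha
        · exact h
      exact PRWFrom_append_cons_of_mem ha h0'

/-- The letter just before `m` is nonzero and smaller than `m`, so there is an ascent before the
letter `0`. -/
theorem not_PRWFrom_append_cons {m : ℕ} {R : List ℕ} :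
    ∀ {L : List ℕ} {p : ℕ}, p ≠ 0 → p < m → 0 ∉ L → (∀ x ∈ L, x < m) →
      ¬ PRWFrom p (L ++ m :: R)
  | [], p, hp, hpm, _, _ => by simp [PRWFrom, hp, hpm.le]
  | a :: L, p, hp, hpm, h0, hL => by
    rw [List.forall_mem_cons] at hL
    rw [List.mem_cons, not_or] at h0
    simp only [List.cons_append, PRWFrom, hp, false_or]
    exact fun h => not_PRWFrom_append_cons (Ne.symm h0.1) hL.1 h0.2 hL.2 h.2

theorem listInv_eq_invSet {T U : Finset ℕ} {L R : List ℕ} (hL : L ∈ arrangements T)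
    (hR : R ∈ arrangements U) : listInv L R = invSet T U := by
  obtain ⟨hL1, hL2⟩ := mem_arrangements.1 hL
  obtain ⟨hR1, hR2⟩ := mem_arrangements.1 hR
  have hc : ∀ a, countLess a R = (U.filter fun b => b < a).card := by
    intro a
    rw [countLess, List.countP_eq_length_filter,
      ← List.toFinset_card_of_nodup (hR1.filter _)]
    congr 1
    ext b
    simp [hR2]
  have hTL : T = L.toFinset := by
    ext x
    simp [hL2]
  rw [hTL, invSet]
  clear hL hL2 hTL
  induction L with
  | nil => simp [listInv]
  | cons a L ih =>
    rw [List.nodup_cons] at hL1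
    rw [listInv, List.toFinset_cons, Finset.sum_insert (by simpa using hL1.1), ih hL1.2, hc]

/-- The monomial `t ^ des * q ^ ai` of a list preceded by the letter `p`; the letter `p` counts
only for the admissible inversions. -/
noncomputable def listWeight (p : ℕ) (l : List ℕ) : ℚ[X][X] :=
  X ^ desFrom 0 l * (C X) ^ aiFrom p l

theorem listWeight_append_cons {m p : ℕ} {S T : Finset ℕ} (hS : ∀ x ∈ S, x < m) (hp : m ≤ p)
    (hT : T ⊆ S) {L R : List ℕ} (hL : L ∈ arrangements T) (hR : R ∈ arrangements (S \ T)) :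
    listWeight p (L ++ m :: R)
      = (C X) ^ invSet T (S \ T) * ((if (S \ T).card = 0 then 1 else X)
        * (if T.card = 0 then 1 else (C X) ^ (S \ T).card))
        * (listWeight p L * listWeight m R) := by
  have hLm : ∀ x ∈ L, x < m := fun x hx => hS x (hT (((mem_arrangements.1 hL).2 x).1 hx))
  have hRm : ∀ x ∈ R, x < m := fun x hx =>
    hS x (Finset.mem_sdiff.1 (((mem_arrangements.1 hR).2 x).1 hx)).1
  have h1 := length_of_mem_arrangements hL
  have h2 := length_of_mem_arrangements hR
  unfold listWeight
  rw [desFrom_append_cons R L 0 (Nat.zero_le _) hLm, desFrom_of_lt hRm,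
    aiFrom_append_cons hRm L p hLm, listInv_eq_invSet hL hR, ← h1, ← h2]
  simp only [List.length_eq_zero_iff, not_lt.2 hp, not_false_eq_true, and_true]
  split_ifs <;> ring

/-- Words with the statistics `(des, ai)` satisfy the recurrence `qEulerian_succ`, by cutting at the
largest letter. The preceding letter `p` exceeds all others, so it makes no inversion admissible;
for the part `R` this role passes to `m`. -/
theorem sum_listWeight (S : Finset ℕ) :
    ∀ p, (∀ x ∈ S, x < p) → ∑ l ∈ arrangements S, listWeight p l = qEulerian S.card := by
  induction hn : S.card using Nat.strong_induction_on generalizing S with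
  | h n ih =>
    intro p hp
    rcases S.eq_empty_or_nonempty with rfl | hne
    · subst hn
      simp [arrangements_empty, listWeight, desFrom, aiFrom, qEulerian_zero]
    · obtain ⟨m, S', hmS', rfl, hS'⟩ : ∃ m S', m ∉ S' ∧ insert m S' = S ∧ ∀ x ∈ S', x < m := by
        refine ⟨S.max' hne, S.erase (S.max' hne), Finset.notMem_erase _ _,
          Finset.insert_erase (S.max'_mem hne), fun x hx => ?_⟩
        exact lt_of_le_of_ne (S.le_max' x (Finset.mem_of_mem_erase hx)) (Finset.ne_of_mem_erase hx)
      rw [Finset.card_insert_of_notMem hmS'] at hn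
      have hmp : m < p := hp m (Finset.mem_insert_self _ _)
      rw [sum_arrangements_insert hmS']
      -- The weight depends only on the two sizes, as `sum_powerset_invSet` requires.
      obtain ⟨W, hW⟩ : ∃ W : ℕ × ℕ → ℚ[X][X], ∀ y, W y = ((if y.2 = 0 then 1 else X)
          * (if y.1 = 0 then 1 else (C X) ^ y.2)) * (qEulerian y.1 * qEulerian y.2) :=
        ⟨_, fun _ => rfl⟩
      have h1 : ∀ T ∈ S'.powerset, ∑ L ∈ arrangements T, ∑ R ∈ arrangements (S' \ T),
            listWeight p (L ++ m :: R)
          = (C X) ^ invSet T (S' \ T) * W (T.card, (S' \ T).card) := by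
        intro T hT
        have hTS := Finset.mem_powerset.1 hT
        have hc1 := Finset.card_le_card hTS
        have hc2 := Finset.card_le_card (Finset.sdiff_subset (s := S') (t := T))
        have e1 := ih T.card (by omega) T rfl p fun x hx =>
          hp x (Finset.mem_insert_of_mem (hTS hx))
        have e2 := ih (S' \ T).card (by omega) (S' \ T) rfl m fun x hx =>
          hS' x (Finset.mem_sdiff.1 hx).1
        rw [hW, ← e1, ← e2, Finset.sum_mul_sum, ← mul_assoc, Finset.mul_sum]
        refine Finset.sum_congr rfl fun L hL => ?_
        rw [Finset.mul_sum]
        refine Finset.sum_congr rfl fun R hR => ?_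
        exact listWeight_append_cons hS' hmp.le hTS hL hR
      rw [Finset.sum_congr rfl h1, sum_powerset_invSet, ← hn, qEulerian_succ]
      simp only [hW]
      -- The exceptional terms, with `T` or its complement empty, are split off; they coincide when
      -- `S'` is empty. The summand `t q^n A n` of the recurrence cancels its subtracted term, and
      -- the summand `t A n` accounts for an empty `L`.
      rcases hk : S'.card with _ | k
      · simp [qEulerian_zero, qBinom_zero_right]
      · rw [Finset.Nat.sum_antidiagonal_succ, Finset.Nat.sum_antidiagonal_succ]
        rcases k with _ | k
        · simp [qEulerian_zero, qBinom_zero_right, qBinom_self]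
          ring
        · rw [Finset.Nat.sum_antidiagonal_succ', Finset.Nat.sum_antidiagonal_succ']
          simp only [qEulerian_zero, qBinom_zero_right, qBinom_self, mul_add, Finset.mul_sum]
          simp
          have h3 : ∀ p ∈ Finset.HasAntidiagonal.antidiagonal k,
              C (qBinom (k + 1 + 1) (p.2 + 1)) * (X * (C X) ^ (p.2 + 1) *
                (qEulerian (p.1 + 1) * qEulerian (p.2 + 1)))
              = X * (C (qBinom (k + 1 + 1) (p.2 + 1)) * (qEulerian (p.1 + 1) *
                ((C X) ^ (p.2 + 1) * qEulerian (p.2 + 1)))) := fun p _ => by ring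
          rw [Finset.sum_congr rfl h3]
          ring

end ListStatistics

/-! ### The sum over PRW words satisfies the recurrence of the `q`-binomial-Eulerian polynomials. -/

section PRWSum

open Classical in
theorem sum_PRWFrom_cons {S : Finset ℕ} {m p : ℕ} (hp : p ≠ 0) (hmp : m < p) (hne : S.Nonempty)
    (hS : ∀ x ∈ S, x < m) :
    ∑ R ∈ arrangements S, (if PRWFrom p ([] ++ m :: R) then listWeight p ([] ++ m :: R) else 0)
      = X * ∑ R ∈ arrangements S, (if PRWFrom m R then listWeight m R else 0) := by
  rw [Finset.mul_sum]
  refine Finset.sum_congr rfl fun R hR => ?_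
  have h1 : PRWFrom p ([] ++ m :: R) ↔ PRWFrom m R := by simp [PRWFrom, hp, hmp]
  have h2 := listWeight_append_cons (p := p) (T := ∅) (L := []) (R := R) hS hmp.le
    (Finset.empty_subset _) (by simp [arrangements_empty]) (by simpa using hR)
  have h3 : listWeight p [] = 1 := by simp [listWeight, desFrom, aiFrom]
  simp only [Finset.sdiff_empty, Finset.card_empty, if_true, if_neg hne.card_ne_zero, h3,
    invSet, Finset.sum_empty, pow_zero, one_mul, mul_one] at h2
  simp only [h1, h2]
  split_ifs <;> simp

open Classical in
theorem sum_PRWFrom_of_zero_notMem {S T : Finset ℕ} {m p : ℕ} (hp : p ≠ 0)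
    (hT : ∀ x ∈ T, x < m) (hT0 : 0 ∉ T) (hne : T.Nonempty) (f : List ℕ → ℚ[X][X]) :
    ∑ L ∈ arrangements T, ∑ R ∈ arrangements (S \ T),
      (if PRWFrom p (L ++ m :: R) then f (L ++ m :: R) else 0) = 0 := by
  refine Finset.sum_eq_zero fun L hL => Finset.sum_eq_zero fun R _ => if_neg ?_
  obtain ⟨_, hL'⟩ := mem_arrangements.1 hL
  cases L with
  | nil =>
    obtain ⟨x, hx⟩ := hne
    simpa using (hL' x).2 hx
  | cons a L =>
    simp only [List.cons_append, PRWFrom, hp, false_or]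
    have ha := (hL' a).1 List.mem_cons_self
    refine fun h => not_PRWFrom_append_cons (fun h0 => hT0 (h0 ▸ ha)) (hT a ha)
      (fun h0 => hT0 ((hL' 0).1 (List.mem_cons_of_mem _ h0)))
      (fun x hx => hT x ((hL' x).1 (List.mem_cons_of_mem _ hx))) h.2

open Classical in
-- Cut at the largest letter `m`. If `0` lies in `L`, only `L` is constrained and `R` is arbitrary,
-- contributing a factor `A`. If `L` is empty, `R` is again a PRW word and the factor is `t`. A
-- nonempty `L` without `0` is impossible.
theorem sum_PRWFrom (S : Finset ℕ) :
    0 ∉ S → ∀ p ≠ 0, (∀ x ∈ S, x < p) →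
      ∑ l ∈ arrangements (insert 0 S), (if PRWFrom p l then listWeight p l else 0)
        = qBinomialEulerian S.card := by
  induction hn : S.card using Nat.strong_induction_on generalizing S with
  | h n ih =>
    intro h0 p hp0 hp
    rcases S.eq_empty_or_nonempty with rfl | hne
    · subst hn
      rw [sum_arrangements_insert (Finset.notMem_empty 0)]
      simp [arrangements_empty, listWeight, desFrom, aiFrom, countLessAfter, PRWFrom,
        qBinomialEulerian_zero, Nat.pos_of_ne_zero hp0]
    · obtain ⟨m, S', hmS', rfl, hS'⟩ : ∃ m S', m ∉ S' ∧ insert m S' = S ∧ ∀ x ∈ S', x < m := by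
        refine ⟨S.max' hne, S.erase (S.max' hne), Finset.notMem_erase _ _,
          Finset.insert_erase (S.max'_mem hne), fun x hx => ?_⟩
        exact lt_of_le_of_ne (S.le_max' x (Finset.mem_of_mem_erase hx)) (Finset.ne_of_mem_erase hx)
      rw [Finset.card_insert_of_notMem hmS'] at hn
      have hmp : m < p := hp m (Finset.mem_insert_self _ _)
      rw [Finset.mem_insert, not_or] at h0
      obtain ⟨hm0, h0⟩ := h0
      have hS0 : ∀ x ∈ insert 0 S', x < m := by
        intro x hx
        rcases Finset.mem_insert.1 hx with rfl | hx
        · omega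
        · exact hS' x hx
      have hm0S : m ∉ insert 0 S' := fun h => lt_irrefl _ (hS0 m h)
      -- The subsets are divided according to whether they contain `0`; among those without `0` only
      -- the empty one contributes.
      rw [Finset.insert_comm, sum_arrangements_insert hm0S, Finset.sum_powerset_insert h0,
        Finset.sum_eq_single ∅]
      · rw [arrangements_empty, Finset.sum_singleton, Finset.sdiff_empty,
          sum_PRWFrom_cons hp0 hmp (Finset.insert_nonempty _ _) hS0,
          ih S'.card (by omega) S' rfl h0 m (Ne.symm hm0) hS']
        obtain ⟨W, hW⟩ : ∃ W : ℕ × ℕ → ℚ[X][X], ∀ y, W y = ((if y.2 = 0 then 1 else X)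
            * (C X) ^ y.2) * (qBinomialEulerian y.1 * qEulerian y.2) := ⟨_, fun _ => rfl⟩
        have h1 : ∀ T ∈ S'.powerset, ∑ L ∈ arrangements (insert 0 T),
              ∑ R ∈ arrangements (insert 0 S' \ insert 0 T),
              (if PRWFrom p (L ++ m :: R) then listWeight p (L ++ m :: R) else 0)
            = (C X) ^ invSet T (S' \ T) * W (T.card, (S' \ T).card) := by
          intro T hT
          have hTS := Finset.mem_powerset.1 hT
          have h0T : 0 ∉ T := fun h => h0 (hTS h)
          have hsd : insert 0 S' \ insert 0 T = S' \ T := by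
            ext x
            simp only [Finset.mem_sdiff, Finset.mem_insert]
            constructor
            · rintro ⟨rfl | hx, hx'⟩
              · exact absurd (Or.inl rfl) hx'
              · exact ⟨hx, fun h => hx' (Or.inr h)⟩
            · rintro ⟨hx, hx'⟩
              refine ⟨Or.inr hx, ?_⟩
              rintro (rfl | h)
              · exact h0 hx
              · exact hx' h
          have hc1 := Finset.card_le_card hTS
          have e1 := ih T.card (by omega) T rfl h0T p hp0 fun x hx =>
            hp x (Finset.mem_insert_of_mem (hTS hx))
          have e2 := sum_listWeight (S' \ T) m fun x hx => hS' x (Finset.mem_sdiff.1 hx).1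
          rw [hW, ← e1, ← e2, Finset.sum_mul_sum, ← mul_assoc, Finset.mul_sum]
          refine Finset.sum_congr rfl fun L hL => ?_
          rw [Finset.mul_sum]
          refine Finset.sum_congr (by rw [hsd]) fun R hR => ?_
          have h0L : 0 ∈ L := ((mem_arrangements.1 hL).2 0).2 (Finset.mem_insert_self _ _)
          have hinv : invSet (insert 0 T) (S' \ T) = invSet T (S' \ T) := by
            rw [invSet, Finset.sum_insert h0T]
            simp [invSet]
          have hw := listWeight_append_cons (p := p) hS0 hmp.le
            (Finset.insert_subset_insert 0 hTS) hL (by rwa [hsd])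
          rw [hsd, hinv, if_neg (Finset.card_ne_zero_of_mem (Finset.mem_insert_self 0 T))] at hw
          rw [PRWFrom_append_cons_of_mem hp0 h0L, hw]
          split_ifs <;> ring
        rw [Finset.sum_congr rfl h1, sum_powerset_invSet, ← hn, qBinomialEulerian_succ]
        simp only [hW]
        -- The term with `R` empty carries no `t` and gives `B n`; the summand `t B n` of the
        -- recurrence comes from the words beginning with `m`.
        rcases hk : S'.card with _ | k
        · simp [qEulerian_zero, qBinom_zero_right]
          ring
        · rw [Finset.Nat.sum_antidiagonal_succ', Finset.Nat.sum_antidiagonal_succ']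
          simp only [qEulerian_zero, qBinom_zero_right, mul_add, Finset.mul_sum]
          simp
          have h3 : ∀ p ∈ Finset.HasAntidiagonal.antidiagonal k,
              C (qBinom (k + 1) (p.2 + 1)) * (X * (C X) ^ (p.2 + 1) *
                (qBinomialEulerian p.1 * qEulerian (p.2 + 1)))
              = X * (C (qBinom (k + 1) (p.2 + 1)) * (qBinomialEulerian p.1 *
                ((C X) ^ (p.2 + 1) * qEulerian (p.2 + 1)))) := fun p _ => by ring
          rw [Finset.sum_congr rfl h3]
          ring
      · intro T hT hT0
        have hTS := Finset.mem_powerset.1 hT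
        exact sum_PRWFrom_of_zero_notMem hp0 (fun x hx => hS' x (hTS hx))
          (fun h => h0 (hTS h)) (Finset.nonempty_iff_ne_empty.2 hT0) _
      · intro h
        exact absurd (Finset.empty_mem_powerset _) h

end PRWSum

/-! ### From lists back to permutations of `Fin (n + 1)`. -/

section Translation

/-- The word of a permutation. -/
def wordList {n : ℕ} (w : Equiv.Perm (Fin n)) : List ℕ :=
  List.ofFn fun i => (w i : ℕ)

theorem sum_perm_eq_sum_arrangements {A : Type*} [AddCommMonoid A] (n : ℕ) (f : List ℕ → A) :
    ∑ w : Equiv.Perm (Fin n), f (wordList w) = ∑ l ∈ arrangements (Finset.range n), f l := by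
  refine Finset.sum_bij (fun w _ => wordList w) ?_ ?_ ?_ fun _ _ => rfl
  · intro w _
    rw [mem_arrangements, wordList, List.nodup_ofFn]
    refine ⟨fun i j h => w.injective (Fin.ext h), fun x => ?_⟩
    rw [List.mem_ofFn, Finset.mem_range]
    constructor
    · rintro ⟨i, rfl⟩
      exact (w i).isLt
    · intro hx
      exact ⟨w.symm ⟨x, hx⟩, by simp⟩
  · intro w _ w' _ h
    have := List.ofFn_injective h
    ext i
    exact congrFun this i
  · intro l hl
    have hlen := length_of_mem_arrangements hl
    rw [Finset.card_range] at hlen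
    obtain ⟨h1, h2⟩ := mem_arrangements.1 hl
    subst hlen
    have hinj : Function.Injective fun i : Fin l.length =>
        (⟨l.get i, Finset.mem_range.1 ((h2 _).1 (l.get_mem i))⟩ : Fin l.length) := by
      intro i j h
      exact List.nodup_iff_injective_get.1 h1 (congrArg Fin.val h)
    refine ⟨Equiv.ofBijective _ (Finite.injective_iff_bijective.1 hinj), Finset.mem_univ _, ?_⟩
    simp [wordList]

/-- The letter before the position `i` in the word `f` preceded by `p`. -/
def prevLetter (p : ℕ) {n : ℕ} (f : Fin n → ℕ) (i : Fin n) : ℕ :=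
  (Fin.cons p f : Fin (n + 1) → ℕ) i.castSucc

theorem prevLetter_zero (p : ℕ) {n : ℕ} (f : Fin (n + 1) → ℕ) : prevLetter p f 0 = p :=
  rfl

theorem prevLetter_succ (p : ℕ) {n : ℕ} (f : Fin (n + 1) → ℕ) (i : Fin n) :
    prevLetter p f i.succ = f i.castSucc := by
  rw [prevLetter, ← Fin.succ_castSucc, Fin.cons_succ]

theorem prevLetter_tail (p : ℕ) {n : ℕ} (f : Fin (n + 1) → ℕ) (i : Fin n) :
    prevLetter (f 0) (fun i => f i.succ) i = prevLetter p f i.succ := by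
  rw [prevLetter_succ, prevLetter]
  exact congrFun (Fin.cons_self_tail f) i.castSucc

theorem desFrom_ofFn {n : ℕ} : ∀ (p : ℕ) (f : Fin n → ℕ),
    desFrom p (List.ofFn f) = ∑ i : Fin n, if f i < prevLetter p f i then 1 else 0 := by
  induction n with
  | zero => intro p f; simp [desFrom]
  | succ n ih =>
    intro p f
    rw [List.ofFn_succ, desFrom, ih, Fin.sum_univ_succ, prevLetter_zero]
    simp only [prevLetter_tail p]

theorem countLess_ofFn {n : ℕ} (a : ℕ) (f : Fin n → ℕ) :
    countLess a (List.ofFn f) = ∑ j, if f j < a then 1 else 0 := by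
  induction n with
  | zero => simp [countLess]
  | succ n ih =>
    rw [Fin.sum_univ_succ, ← ih fun i => f i.succ, List.ofFn_succ, countLess, countLess,
      List.countP_cons, add_comm]
    simp

theorem countLessAfter_ofFn {n : ℕ} (a : ℕ) (f : Fin n → ℕ) :
    countLessAfter a (List.ofFn f) = ∑ j, if f j < a ∧ ∃ k < j, a < f k then 1 else 0 := by
  induction n with
  | zero => simp [countLessAfter]
  | succ n ih =>
    rw [Fin.sum_univ_succ, List.ofFn_succ, countLessAfter, ih, countLess_ofFn]
    simp only [Fin.not_lt_zero, false_and, exists_false, and_false, if_false, zero_add,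
      Fin.exists_fin_succ, Fin.succ_pos, true_and, Fin.succ_lt_succ_iff]
    split_ifs with h <;> simp [h]

theorem aiFrom_ofFn {n : ℕ} : ∀ (p : ℕ) (f : Fin n → ℕ),
    aiFrom p (List.ofFn f) = ∑ i : Fin n, ∑ j : Fin n,
      if (i < j ∧ f j < f i) ∧ (prevLetter p f i < f i ∨ ∃ k, i < k ∧ k < j ∧ f i < f k)
        then 1 else 0 := by
  induction n with
  | zero => intro p f; simp [aiFrom]
  | succ n ih =>
    intro p f
    rw [List.ofFn_succ, aiFrom, ih, countLess_ofFn, countLessAfter_ofFn, Fin.sum_univ_succ]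
    congr 1
    · rw [Fin.sum_univ_succ, prevLetter_zero]
      simp only [lt_irrefl, false_and, if_false, zero_add, Fin.succ_pos, true_and,
        Fin.exists_fin_succ, false_or, Fin.succ_lt_succ_iff]
      split_ifs with h <;> simp [h]
    · refine Finset.sum_congr rfl fun i _ => ?_
      rw [Fin.sum_univ_succ]
      simp only [prevLetter_tail p, Fin.not_lt_zero, false_and, if_false, zero_add,
        Fin.exists_fin_succ, false_or, Fin.succ_lt_succ_iff]

theorem PRWFrom_ofFn {n : ℕ} : ∀ (p : ℕ) (f : Fin n → ℕ),
    PRWFrom p (List.ofFn f) ↔ ∀ i : Fin n, ¬ f i < prevLetter p f i →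
      (∀ j < i, f j < prevLetter p f j) → prevLetter p f i = 0 := by
  induction n with
  | zero => intro p f; simp [PRWFrom]
  | succ n ih =>
    intro p f
    rw [List.ofFn_succ, PRWFrom, ih, Fin.forall_fin_succ]
    simp only [prevLetter_tail p, prevLetter_zero, Fin.not_lt_zero, Fin.forall_fin_succ,
      Fin.succ_lt_succ_iff, Fin.succ_pos, forall_true_left, false_imp_iff, implies_true]
    by_cases h : f 0 < p
    · have hp : p ≠ 0 := by omega
      simp [h, hp]
    · simp [h]

theorem desFrom_wordList {n : ℕ} (w : Equiv.Perm (Fin (n + 1))) :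
    desFrom 0 (wordList w) = des w := by
  rw [wordList, desFrom_ofFn, Fin.sum_univ_succ, prevLetter_zero, des, Finset.card_filter,
    Fin.sum_univ_castSucc]
  have h : ¬ IsDescent w (Fin.last n) := fun ⟨h, _⟩ => by simp at h
  simp only [not_lt_zero, if_false, zero_add, prevLetter_succ, h, add_zero]
  refine Finset.sum_congr rfl fun i _ => ?_
  congr 1
  exact propext ⟨fun h => ⟨by simp, h⟩, fun ⟨_, h⟩ => h⟩

/-- The fictitious first letter `n + 1` exceeds all letters, so the first position counts as having
no smaller predecessor. -/
theorem aiFrom_wordList {n : ℕ} (w : Equiv.Perm (Fin (n + 1))) :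
    aiFrom (n + 1) (wordList w) = ai w := by
  have hprev : ∀ i, prevLetter (n + 1) (fun i => (w i : ℕ)) i < w i
      ↔ ∃ k : Fin (n + 1), (k : ℕ) + 1 = (i : ℕ) ∧ w k < w i := by
    intro i
    refine Fin.cases ?_ (fun i => ?_) i
    · rw [prevLetter_zero]
      have := (w 0).isLt
      exact ⟨fun h => absurd h (by omega), fun ⟨k, hk, _⟩ => by simp at hk⟩
    · rw [prevLetter_succ]
      constructor
      · exact fun h => ⟨i.castSucc, by simp, h⟩
      · rintro ⟨k, hk, hlt⟩
        obtain rfl : k = i.castSucc := Fin.ext (by simpa using hk)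
        exact hlt
  rw [wordList, aiFrom_ofFn, ai, Finset.card_filter, Fintype.sum_prod_type]
  simp only [hprev]
  rfl

theorem PRWFrom_wordList {n : ℕ} (w : Equiv.Perm (Fin (n + 1))) :
    PRWFrom (n + 1) (wordList w) ↔ IsPRW w := by
  have hlast : ¬ IsAscent w (Fin.last n) := fun ⟨h, _⟩ => by simp at h
  have hasc : ∀ i : Fin n, IsAscent w i.castSucc ↔ ¬ (w i.succ : ℕ) < w i.castSucc := by
    intro i
    have hne : (w i.castSucc : ℕ) ≠ w i.succ := fun h =>
      Fin.castSucc_lt_succ.ne (w.injective (Fin.ext h))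
    constructor
    · rintro ⟨_, h⟩
      exact not_lt.2 (le_of_lt h)
    · intro h
      exact ⟨by simp, Fin.lt_def.2 (lt_of_le_of_ne (not_lt.1 h) hne)⟩
  have h0 : (w 0 : ℕ) < n + 1 := (w 0).isLt
  have hall : ∀ i : Fin n, (∀ j < i.castSucc, ¬ IsAscent w j)
      ↔ ∀ j < i.succ, (w j : ℕ) < prevLetter (n + 1) (fun i => (w i : ℕ)) j := by
    intro i
    have hl : ¬ Fin.last n < i.castSucc := not_lt.2 (Fin.le_last _)
    rw [Fin.forall_fin_succ', Fin.forall_fin_succ]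
    simp [hl, hasc, prevLetter_zero, prevLetter_succ, h0]
  rw [wordList, PRWFrom_ofFn, IsPRW, Fin.forall_fin_succ]
  constructor
  · rintro ⟨-, h⟩ i
    refine Fin.lastCases (fun h' => absurd h' hlast) (fun i => ?_) i
    rw [hasc, hall]
    simpa only [prevLetter_succ] using h i
  · intro h
    refine ⟨fun h' => absurd h0 h', fun i => ?_⟩
    have := h i.castSucc
    rw [hasc, hall] at this
    simpa only [prevLetter_succ] using this

end Translation
end QBinEul

theorem theorem1p1 (n : ℕ) (hn : 1 ≤ n) :
    QBinEul.qBinomialEulerian n =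
      ∑ w ∈ QBinEul.PRW (n + 1),
        (X : ℚ[X][X]) ^ QBinEul.des w * (C X) ^ QBinEul.ai w := by
  classical
  -- The nonzero letters are `1, …, n`, and the fictitious letter before the word is `n + 1`.
  have h := QBinEul.sum_PRWFrom ((Finset.range (n + 1)).erase 0) (Finset.notMem_erase 0 _) (n + 1)
    (Nat.succ_ne_zero n) fun x hx => Finset.mem_range.1 (Finset.mem_of_mem_erase hx)
  have h0 : 0 ∈ Finset.range (n + 1) := Finset.mem_range.2 (Nat.succ_pos n)
  rw [Finset.insert_erase h0, Finset.card_erase_of_mem h0, Finset.card_range, Nat.add_sub_cancel,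
    ← QBinEul.sum_perm_eq_sum_arrangements] at h
  rw [← h, QBinEul.PRW, Finset.sum_filter]
  refine Finset.sum_congr rfl fun w _ => ?_
  simp only [QBinEul.PRWFrom_wordList, QBinEul.listWeight, QBinEul.desFrom_wordList,
    QBinEul.aiFrom_wordList]
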